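/- Let $a,b\in\mathbb{C}$ with $|b|<|a|$, let $h(z)=az+b\bar z$ (an arbitrary invertible orientation-preserving real-linear map of the plane; the stretch $h_{K,\theta}$ by a factor $K>0$ in direction $e^{i\theta}$ is $a=\frac{K+1}{2}$, $b=e^{2i\theta}\frac{K-1}{2}$), let $c\in\mathbb{C}$, and put $H(z)=h(z)^2$ and $f(z)=H(z)+c$. For $g:\mathbb{C}\to\mathbb{C}$ let $I(g)=\{z: g^n(z)\to\infty\}$ be the escaping set. Let $\psi$ be the Böttcher map of $f$, defined near infinity as $\psi=\lim_{k\to\infty}\psi_k$, where $\psi_0=\mathrm{id}$ and $$\psi_{k+1}(z)=h^{-1}\Big(h(z)\exp\Big(\tfrac12\log\frac{\psi_k(f(z))}{h(z)^2}\Big)\Big)$$ with the branch of the logarithm that tends to $0$ at infinity, so that $H\circ\psi_{k+1}=\psi_k\circ f$ near infinity. For a set $D$ containing a neighbourhood of infinity and with $f(D)\subseteq D$, an extension of $\psi$ to $D$ means a continuous map $\Psi:D\to\mathbb{C}$ which equals $\psi$ near infinity and satisfies $H\circ\Psi=\Psi\circ f$ on $D$. A quasiconformal map is an injective continuous map in $W^{1,2}_{loc}$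 of an open set with $|\Psi'|^2\le K J_\Psi$ almost everywhere for some finite constant $K\ge 1$; locally quasiconformal means quasiconformal on a neighbourhood of each point. (i) If $0\notin I(f)$, then $\psi$ has an extension $\Psi$ to $I(f)$ which is injective and locally quasiconformal and maps $I(f)$ into $I(H)$. (ii) If $0\in I(f)$, then $\psi$ has no extension to all of $I(f)$; but there is a domain $D\subseteq I(f)$ which contains $c$ and a neighbourhood of infinity, with $f(D)\subseteq D$, and an extension $\Psi$ of $\psi$ to $D$ which is injective, is quasiconformal on $D$, and maps $D$ into $I(H)$. -/

import Mathlib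

open Filter Topology MeasureTheory
open scoped ContDiff ComplexConjugate

/-! ### Quasiconformal mappings of plane open sets (analytic definition) -/

/-- `f'` is a weak (distributional) derivative of `f` on the open set `G ⊆ ℂ = ℝ²`:
`∫ (∂_v φ) f = - ∫ φ (∂_v f)` for all real test functions `φ` supported in `G` and all
directions `v`. -/
def HasWeakFDerivOn (f : ℂ → ℂ) (f' : ℂ → ℂ →L[ℝ] ℂ) (G : Set ℂ) : Prop :=
  ∀ φ : ℂ → ℝ, ContDiff ℝ ∞ φ → HasCompactSupport φ → tsupport φ ⊆ G →
    ∀ v : ℂ, ∫ z, (fderiv ℝ φ z v) • f z = -∫ z, φ z • f' z v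

/-- `f` is `K`-quasiregular on the open set `G`: `f` is continuous, belongs to the Sobolev space
`W^{1,2}_loc(G)`, and its weak derivative satisfies `|f'|² ≤ K J_f` almost everywhere in `G`
(operator norm for the Euclidean norm of `ℂ`, `J_f` the Jacobian determinant). -/
def IsQuasiregularOn (K : ℝ) (f : ℂ → ℂ) (G : Set ℂ) : Prop :=
  IsOpen G ∧ ContinuousOn f G ∧ ∃ f' : ℂ → ℂ →L[ℝ] ℂ,
    HasWeakFDerivOn f f' G ∧
    (∀ C : Set ℂ, IsCompact C → C ⊆ G →
      MemLp f 2 (volume.restrict C) ∧ MemLp f' 2 (volume.restrict C)) ∧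
    ∀ᵐ z ∂(volume.restrict G), ‖f' z‖ ^ 2 ≤ K * (f' z).det

/-- Quasiconformal: injective and `K`-quasiregular for some finite `K ≥ 1`. -/
def IsQuasiconformalOn (f : ℂ → ℂ) (G : Set ℂ) : Prop :=
  Set.InjOn f G ∧ ∃ K : ℝ, 1 ≤ K ∧ IsQuasiregularOn K f G

/-- Locally quasiconformal on `G`: quasiconformal on a neighbourhood of every point of `G`. -/
def IsLocallyQuasiconformalOn (f : ℂ → ℂ) (G : Set ℂ) : Prop :=
  ∀ z ∈ G, ∃ V : Set ℂ, z ∈ V ∧ V ⊆ G ∧ IsQuasiconformalOn f V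

/-! ### The mappings `H = h²` and `f = h² + c` -/

/-- The escaping set `I(g) = {z : gⁿ(z) → ∞}`. -/
def escapingSet (g : ℂ → ℂ) : Set ℂ :=
  {z | Tendsto (fun n : ℕ => g^[n] z) atTop (cocompact ℂ)}

/-- The real-linear map `h(z) = a z + b z̄`. For `|b| < |a|` these are exactly the orientation
preserving invertible real-linear maps of the plane; the stretch by the factor `K > 0` in the
direction `e^{iθ}` is the case `a = (K + 1) / 2`, `b = e^{2iθ} (K - 1) / 2`. -/
noncomputable def stretch (a b z : ℂ) : ℂ := a * z + b * conj z

/-- The inverse of `stretch a b` when `|b| < |a|`. -/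
noncomputable def stretchInv (a b w : ℂ) : ℂ :=
  (conj a * w - b * conj w) / (((‖a‖ ^ 2 - ‖b‖ ^ 2 : ℝ)) : ℂ)

theorem stretch_stretchInv {a b : ℂ} (hab : ‖b‖ < ‖a‖) (w : ℂ) :
    stretch a b (stretchInv a b w) = w := by
  have hpos : (0 : ℝ) < ‖a‖ ^ 2 - ‖b‖ ^ 2 := by nlinarith [norm_nonneg a, norm_nonneg b]
  have hne : (((‖a‖ ^ 2 - ‖b‖ ^ 2 : ℝ)) : ℂ) ≠ 0 := by exact_mod_cast hpos.ne'
  have ha := Complex.mul_conj' a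
  have hb := Complex.mul_conj' b
  unfold stretch stretchInv
  rw [map_div₀, Complex.conj_ofReal]
  field_simp
  simp only [map_sub, map_mul, Complex.conj_conj]
  push_cast
  linear_combination w * ha - w * hb

theorem stretchInv_stretch {a b : ℂ} (hab : ‖b‖ < ‖a‖) (z : ℂ) :
    stretchInv a b (stretch a b z) = z := by
  have hpos : (0 : ℝ) < ‖a‖ ^ 2 - ‖b‖ ^ 2 := by nlinarith [norm_nonneg a, norm_nonneg b]
  have hne : (((‖a‖ ^ 2 - ‖b‖ ^ 2 : ℝ)) : ℂ) ≠ 0 := by exact_mod_cast hpos.ne'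
  have ha := Complex.mul_conj' a
  have hb := Complex.mul_conj' b
  unfold stretch stretchInv
  field_simp
  simp only [map_add, map_mul, Complex.conj_conj]
  push_cast
  linear_combination z * ha - z * hb

/-- `H(z) = h(z)²`. -/
noncomputable def mapH (a b z : ℂ) : ℂ := stretch a b z ^ 2

/-- `f(z) = H(z) + c = h(z)² + c`. -/
noncomputable def mapF (a b c z : ℂ) : ℂ := mapH a b z + c

/-! ### The Böttcher map -/

/-- The maps `ψ₀ = id`, `ψ_{k+1} = h⁻¹ ∘ q ∘ h` with `q(w) = w exp (p(w) / 2)`,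
`p(w) = log (ψ_k(w² + c) / w²)`, so that `q² = ψ_k ∘ (w ↦ w² + c)` and
`H ∘ ψ_{k+1} = ψ_k ∘ f` near infinity. With the principal logarithm, `p` is near infinity the
continuous branch which tends to `0` at infinity. -/
noncomputable def bottcherSeq (a b c : ℂ) : ℕ → ℂ → ℂ
  | 0, z => z
  | k + 1, z => stretchInv a b
      (stretch a b z *
        Complex.exp (Complex.log (bottcherSeq a b c k (mapF a b c z) / stretch a b z ^ 2) / 2))

/-- `Ψ` is defined on the set `D`, which contains a neighbourhood of infinity, and agrees near
infinity with the Böttcher map `ψ = lim ψ_k`. -/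
def ExtendsBottcher (a b c : ℂ) (Ψ : ℂ → ℂ) (D : Set ℂ) : Prop :=
  ∃ R : ℝ, ∀ z : ℂ, R < ‖z‖ →
    z ∈ D ∧ Tendsto (fun k : ℕ => bottcherSeq a b c k z) atTop (𝓝 (Ψ z))

/-- `Ψ` continues the Böttcher map to `D` as a continuous conjugacy from `f` to `H`: `D` is mapped
into itself by `f`, `Ψ` agrees with the Böttcher map near infinity, is continuous on `D`, and
`H ∘ Ψ = Ψ ∘ f` on `D`. -/
structure IsBottcherExtension (a b c : ℂ) (Ψ : ℂ → ℂ) (D : Set ℂ) : Prop where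
  extends_bottcher : ExtendsBottcher a b c Ψ D
  mapsTo : Set.MapsTo (mapF a b c) D D
  continuousOn : ContinuousOn Ψ D
  conjugacy : ∀ z ∈ D, mapH a b (Ψ z) = Ψ (mapF a b c z)

/-! ### Real-linear maps of the plane -/

/-! Near infinity the added constant is negligible, so `f` and `H` can be conjugated there by
repeated lifting. `conjSeq a b p q` does this for two constants `p` and `q` at once: `p = c, q = 0`
gives the Böttcher maps, and `p = 0, q = c` gives a candidate inverse. Since `H` expands small
distances by a factor of at least two far out, successive lifts differ by a geometric series and
converge. Their derivatives converge too, because the growth of `|z|` under `f` outweighs the factor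
lost by conjugating with `h`. The limits are `C¹`, with derivative close to the identity. The two
compositions move points by at most 2 and commute with an expanding map, so they are the identity
(`IsLargeRadius.eq_of_shadowing`). This gives a pair of inverse conjugacies `φ : V → U`, `Ψ : U → V`
near infinity (`isConjPair_base`).

The pair is then pulled back (`IsConjPair.exists_preimage`). If `c ∉ U`, then `φ ∘ H - c` has no
zero on `H⁻¹(V)` and its square root yields the new `φ`. It is more convenient to lift `φ` than `Ψ`,
because the sets in the plane of `H` are explicit: `H (t z) = t² H z` for real `t`, so preimages of
radial sets are radial. Radial sets avoiding 0 and containing a neighbourhood of infinity are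
connected, and a square root known near infinity extends along rays by homotopy lifting. Each
pullback multiplies the distortion constant by the square of the dilatation of `h`, so finitely many
pullbacks remain quasiconformal.

If 0 does not escape, neither does `c`, and the pullbacks exhaust `I(f)`. Uniqueness
(`IsConjPair.eqOn_of_extension`) lets them be glued; the distortion bounds may grow without limit,
which is why quasiconformality is only local. If 0 escapes, pulling back stops at the first `U`
containing `c`, and this is `D`. Any extension to all of `I(f)` would be odd along a lifted curve
tending to the critical point 0, hence vanish at 0, forcing `Ψ c = H 0 = 0`, whereas `Ψ c` lies in
`V` and `0 ∉ V` (`IsConjPair.not_exists_extension`). -/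

theorem stretch_neg (a b z : ℂ) : stretch a b (-z) = -stretch a b z := by
  simp only [stretch, map_neg]; ring

theorem stretch_sub (a b z w : ℂ) : stretch a b (z - w) = stretch a b z - stretch a b w := by
  simp only [stretch, map_sub]; ring

theorem stretch_real_mul (a b z : ℂ) (t : ℝ) : stretch a b (t * z) = t * stretch a b z := by
  simp only [stretch, map_mul, Complex.conj_ofReal]; ring

theorem stretch_zero (a b : ℂ) : stretch a b 0 = 0 := by simp [stretch]

theorem norm_stretch_le (a b z : ℂ) : ‖stretch a b z‖ ≤ (‖a‖ + ‖b‖) * ‖z‖ := by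
  calc ‖stretch a b z‖ ≤ ‖a * z‖ + ‖b * conj z‖ := norm_add_le _ _
    _ = (‖a‖ + ‖b‖) * ‖z‖ := by rw [norm_mul, norm_mul, Complex.norm_conj]; ring

theorem le_norm_stretch (a b z : ℂ) : (‖a‖ - ‖b‖) * ‖z‖ ≤ ‖stretch a b z‖ := by
  have h := norm_sub_norm_le (a * z) (-(b * conj z))
  rw [sub_neg_eq_add, norm_neg, norm_mul, norm_mul, Complex.norm_conj] at h
  calc (‖a‖ - ‖b‖) * ‖z‖ = ‖a‖ * ‖z‖ - ‖b‖ * ‖z‖ := by ring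
    _ ≤ _ := h

theorem stretch_ne_zero {a b z : ℂ} (hab : ‖b‖ < ‖a‖) (hz : z ≠ 0) : stretch a b z ≠ 0 := by
  intro h
  apply hz
  rw [← stretchInv_stretch hab z, h]
  simp [stretchInv]

theorem norm_stretchInv_le {a b : ℂ} (hab : ‖b‖ < ‖a‖) (w : ℂ) :
    ‖stretchInv a b w‖ ≤ ‖w‖ / (‖a‖ - ‖b‖) := by
  rw [le_div_iff₀ (sub_pos.2 hab), mul_comm]
  simpa only [stretch_stretchInv hab] using le_norm_stretch a b (stretchInv a b w)

/-- `stretch a b` as a continuous real-linear map. -/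
noncomputable def stretchCLM (a b : ℂ) : ℂ →L[ℝ] ℂ :=
  a • ContinuousLinearMap.id ℝ ℂ + b • Complex.conjCLE.toContinuousLinearMap

theorem stretchCLM_apply (a b z : ℂ) : stretchCLM a b z = stretch a b z := by
  simp [stretchCLM, stretch]

theorem stretchInv_eq_stretch (a b w : ℂ) : stretchInv a b w =
    stretch (conj a / ((‖a‖ ^ 2 - ‖b‖ ^ 2 : ℝ) : ℂ)) (-b / ((‖a‖ ^ 2 - ‖b‖ ^ 2 : ℝ) : ℂ)) w := by
  simp only [stretchInv, stretch]; ring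

/-- `stretch a b` as a continuous real-linear automorphism of the plane. -/
noncomputable def stretchCLE {a b : ℂ} (hab : ‖b‖ < ‖a‖) : ℂ ≃L[ℝ] ℂ :=
  ContinuousLinearEquiv.equivOfInverse (stretchCLM a b)
    (stretchCLM (conj a / ((‖a‖ ^ 2 - ‖b‖ ^ 2 : ℝ) : ℂ)) (-b / ((‖a‖ ^ 2 - ‖b‖ ^ 2 : ℝ) : ℂ)))
    (fun z => by
      rw [stretchCLM_apply, stretchCLM_apply, ← stretchInv_eq_stretch, stretchInv_stretch hab])
    (fun z => by
      rw [stretchCLM_apply, stretchCLM_apply, ← stretchInv_eq_stretch, stretch_stretchInv hab])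

theorem stretchCLE_apply {a b : ℂ} (hab : ‖b‖ < ‖a‖) (z : ℂ) :
    stretchCLE hab z = stretch a b z := stretchCLM_apply a b z

theorem stretchCLE_symm_apply {a b : ℂ} (hab : ‖b‖ < ‖a‖) (z : ℂ) :
    (stretchCLE hab).symm z = stretchInv a b z := by
  rw [stretchInv_eq_stretch, ← stretchCLM_apply]; rfl

theorem stretchInv_sub {a b : ℂ} (hab : ‖b‖ < ‖a‖) (z w : ℂ) :
    stretchInv a b (z - w) = stretchInv a b z - stretchInv a b w := by
  simp only [← stretchCLE_symm_apply hab, map_sub]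

theorem continuous_stretch (a b : ℂ) : Continuous (stretch a b) := by
  have : stretch a b = stretchCLM a b := funext fun z => (stretchCLM_apply a b z).symm
  rw [this]; exact (stretchCLM a b).continuous

theorem continuous_stretchInv {a b : ℂ} (hab : ‖b‖ < ‖a‖) : Continuous (stretchInv a b) := by
  have : stretchInv a b = (stretchCLE hab).symm :=
    funext fun z => (stretchCLE_symm_apply hab z).symm
  rw [this]; exact (stretchCLE hab).symm.continuous

/-- Multiplication by a nonzero complex number as a real-linear automorphism of the plane. -/
noncomputable def mulCLE {u : ℂ} (hu : u ≠ 0) : ℂ ≃L[ℝ] ℂ :=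
  ContinuousLinearEquiv.equivOfInverse (u • ContinuousLinearMap.id ℝ ℂ)
    (u⁻¹ • ContinuousLinearMap.id ℝ ℂ) (fun z => by simp [hu]) (fun z => by simp [hu])

theorem det_smul_id (u : ℂ) : LinearMap.det
    ((u • ContinuousLinearMap.id ℝ ℂ : ℂ →L[ℝ] ℂ) : ℂ →ₗ[ℝ] ℂ) = ‖u‖ ^ 2 := by
  rw [← LinearMap.det_toMatrix Complex.basisOneI, Matrix.det_fin_two]
  simp [LinearMap.toMatrix_apply, ← Complex.normSq_eq_norm_sq, Complex.normSq_apply]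

theorem det_eq (A : ℂ →L[ℝ] ℂ) :
    A.det = (A 1).re * (A Complex.I).im - (A Complex.I).re * (A 1).im := by
  rw [ContinuousLinearMap.det, ← LinearMap.det_toMatrix Complex.basisOneI, Matrix.det_fin_two]
  simp [LinearMap.toMatrix_apply]

/-- The conjugate of `B` which is the derivative of a lift through `mapH`. -/
noncomputable def conjStep {a b : ℂ} (hab : ‖b‖ < ‖a‖) (u v : ℂ) (B : ℂ →L[ℝ] ℂ) : ℂ →L[ℝ] ℂ :=
  ((stretchCLE hab).symm : ℂ →L[ℝ] ℂ) ∘L (u⁻¹ • ContinuousLinearMap.id ℝ ℂ) ∘L B ∘L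
    (v • ContinuousLinearMap.id ℝ ℂ) ∘L (stretchCLE hab : ℂ →L[ℝ] ℂ)

theorem conjStep_apply {a b : ℂ} (hab : ‖b‖ < ‖a‖) (u v : ℂ) (B : ℂ →L[ℝ] ℂ) (z : ℂ) :
    conjStep hab u v B z = stretchInv a b (u⁻¹ * B (v * stretch a b z)) := by
  simp [conjStep, stretchCLE_apply, stretchCLE_symm_apply]

/-- Conjugation by `h` leaves the determinant unchanged, so only the two complex multiplications
contribute. -/
theorem det_conjStep {a b : ℂ} (hab : ‖b‖ < ‖a‖) (u v : ℂ) (B : ℂ →L[ℝ] ℂ) :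
    (conjStep hab u v B).det = ‖u⁻¹‖ ^ 2 * ‖v‖ ^ 2 * B.det := by
  let X : ℂ →L[ℝ] ℂ := (u⁻¹ • ContinuousLinearMap.id ℝ ℂ) ∘L B ∘L (v • ContinuousLinearMap.id ℝ ℂ)
  have h1 : ((conjStep hab u v B : ℂ →L[ℝ] ℂ) : ℂ →ₗ[ℝ] ℂ) =
      ((stretchCLE hab).symm.toLinearEquiv : ℂ →ₗ[ℝ] ℂ) ∘ₗ (X : ℂ →ₗ[ℝ] ℂ) ∘ₗ
        ((stretchCLE hab).symm.toLinearEquiv.symm : ℂ →ₗ[ℝ] ℂ) := rfl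
  rw [ContinuousLinearMap.det, h1, LinearMap.det_conj]
  have h2 : (X : ℂ →ₗ[ℝ] ℂ) = ((u⁻¹ • ContinuousLinearMap.id ℝ ℂ : ℂ →L[ℝ] ℂ) : ℂ →ₗ[ℝ] ℂ) ∘ₗ
    (B : ℂ →ₗ[ℝ] ℂ) ∘ₗ ((v • ContinuousLinearMap.id ℝ ℂ : ℂ →L[ℝ] ℂ) : ℂ →ₗ[ℝ] ℂ) := rfl
  rw [h2, LinearMap.det_comp, LinearMap.det_comp, det_smul_id, det_smul_id,
    ContinuousLinearMap.det]
  ring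

theorem norm_conjStep_le {a b : ℂ} (hab : ‖b‖ < ‖a‖) (u v : ℂ) (B : ℂ →L[ℝ] ℂ) :
    ‖conjStep hab u v B‖ ≤ (‖a‖ + ‖b‖) / (‖a‖ - ‖b‖) * (‖u⁻¹‖ * ‖v‖ * ‖B‖) := by
  have hm := sub_pos.2 hab
  refine ContinuousLinearMap.opNorm_le_bound _ (by positivity) fun z => ?_
  rw [conjStep_apply]
  refine (norm_stretchInv_le hab _).trans ?_
  rw [div_le_iff₀ hm, norm_mul]
  have h1 : ‖B (v * stretch a b z)‖ ≤ ‖B‖ * (‖v‖ * ((‖a‖ + ‖b‖) * ‖z‖)) := by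
    refine (B.le_opNorm _).trans ?_
    rw [norm_mul]
    gcongr
    exact norm_stretch_le a b z
  calc ‖u⁻¹‖ * ‖B (v * stretch a b z)‖ ≤ ‖u⁻¹‖ * (‖B‖ * (‖v‖ * ((‖a‖ + ‖b‖) * ‖z‖))) := by gcongr
    _ = _ := by field_simp

/-- The conformal factors `u⁻¹` and `v` scale squared norm and determinant alike; only the
conjugation by `h` costs distortion. -/
theorem conjStep_distortion {a b : ℂ} (hab : ‖b‖ < ‖a‖) (u v : ℂ) {B : ℂ →L[ℝ] ℂ} {K : ℝ}
    (hB : ‖B‖ ^ 2 ≤ K * B.det) : ‖conjStep hab u v B‖ ^ 2 ≤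
      ((‖a‖ + ‖b‖) / (‖a‖ - ‖b‖)) ^ 2 * K * (conjStep hab u v B).det := by
  calc ‖conjStep hab u v B‖ ^ 2
      ≤ ((‖a‖ + ‖b‖) / (‖a‖ - ‖b‖) * (‖u⁻¹‖ * ‖v‖ * ‖B‖)) ^ 2 := by
        gcongr; exact norm_conjStep_le hab u v B
    _ = ((‖a‖ + ‖b‖) / (‖a‖ - ‖b‖)) ^ 2 * (‖u⁻¹‖ ^ 2 * ‖v‖ ^ 2) * ‖B‖ ^ 2 := by ring
    _ ≤ ((‖a‖ + ‖b‖) / (‖a‖ - ‖b‖)) ^ 2 * (‖u⁻¹‖ ^ 2 * ‖v‖ ^ 2) * (K * B.det) := by gcongr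
    _ = _ := by rw [det_conjStep]; ring

/-- The matrix entries are within `1/4` of those of the identity, so the determinant is at least
`9/16 - 1/16 = 1/2`, while the squared norm is at most `25/16 ≤ 2`. -/
theorem distortion_of_near_id {A : ℂ →L[ℝ] ℂ}
    (hA : ‖A - ContinuousLinearMap.id ℝ ℂ‖ ≤ 1 / 4) : ‖A‖ ^ 2 ≤ 4 * A.det := by
  have hn : ‖A‖ ≤ 5 / 4 := by
    calc ‖A‖ = ‖(A - ContinuousLinearMap.id ℝ ℂ) + ContinuousLinearMap.id ℝ ℂ‖ := by simp
      _ ≤ 1 / 4 + 1 := (norm_add_le _ _).trans (add_le_add hA ContinuousLinearMap.norm_id_le)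
      _ = 5 / 4 := by norm_num
  have h1 : ‖A 1 - 1‖ ≤ 1 / 4 := by
    have := (A - ContinuousLinearMap.id ℝ ℂ).le_of_opNorm_le hA 1
    simpa using this
  have h2 : ‖A Complex.I - Complex.I‖ ≤ 1 / 4 := by
    have := (A - ContinuousLinearMap.id ℝ ℂ).le_of_opNorm_le hA Complex.I
    simpa using this
  have r1 := abs_le.1 ((Complex.abs_re_le_norm _).trans h1)
  have i1 := abs_le.1 ((Complex.abs_im_le_norm _).trans h1)
  have r2 := abs_le.1 ((Complex.abs_re_le_norm _).trans h2)
  have i2 := abs_le.1 ((Complex.abs_im_le_norm _).trans h2)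
  simp only [Complex.sub_re, Complex.sub_im, Complex.one_re, Complex.one_im, Complex.I_re,
    Complex.I_im] at r1 i1 r2 i2
  rw [det_eq]
  have hp : (9 : ℝ) / 16 ≤ (A 1).re * (A Complex.I).im := by nlinarith
  have hq : (A Complex.I).re * (A 1).im ≤ 1 / 16 := by
    have : |(A Complex.I).re * (A 1).im| ≤ 1 / 4 * (1 / 4) := by
      rw [abs_mul]
      gcongr <;> rw [abs_le] <;> constructor <;> linarith
    linarith [le_abs_self ((A Complex.I).re * (A 1).im)]
  nlinarith [norm_nonneg A]

/-! ### The quadratic maps -/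

theorem mapH_neg (a b z : ℂ) : mapH a b (-z) = mapH a b z := by
  simp [mapH, stretch_neg]

theorem mapF_neg (a b c z : ℂ) : mapF a b c (-z) = mapF a b c z := by
  simp [mapF, mapH_neg]

theorem mapF_zero_right (a b z : ℂ) : mapF a b 0 z = mapH a b z := by simp [mapF]

theorem mapH_real_mul (a b z : ℂ) (t : ℝ) : mapH a b (t * z) = (t ^ 2 : ℝ) * mapH a b z := by
  simp only [mapH, stretch_real_mul]; push_cast; ring

theorem mapH_zero (a b : ℂ) : mapH a b 0 = 0 := by simp [mapH, stretch_zero]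

theorem mapF_zero (a b c : ℂ) : mapF a b c 0 = c := by simp [mapF, mapH_zero]

theorem stretch_injective {a b : ℂ} (hab : ‖b‖ < ‖a‖) : Function.Injective (stretch a b) :=
  Function.LeftInverse.injective (stretchInv_stretch hab)

theorem mapH_eq_mapH_iff {a b : ℂ} (hab : ‖b‖ < ‖a‖) {z w : ℂ} :
    mapH a b z = mapH a b w ↔ z = w ∨ z = -w := by
  rw [mapH, mapH, sq_eq_sq_iff_eq_or_eq_neg, ← stretch_neg, (stretch_injective hab).eq_iff,
    (stretch_injective hab).eq_iff]

theorem mapF_eq_mapF_iff {a b c : ℂ} (hab : ‖b‖ < ‖a‖) {z w : ℂ} :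
    mapF a b c z = mapF a b c w ↔ z = w ∨ z = -w := by
  rw [mapF, mapF, add_left_inj, mapH_eq_mapH_iff hab]

theorem mapH_surjective {a b : ℂ} (hab : ‖b‖ < ‖a‖) : Function.Surjective (mapH a b) := by
  intro w
  obtain ⟨s, hs⟩ := IsAlgClosed.exists_pow_nat_eq w (n := 2) (by norm_num)
  exact ⟨stretchInv a b s, by rw [mapH, stretch_stretchInv hab, hs]⟩

theorem continuous_mapH (a b : ℂ) : Continuous (mapH a b) := (continuous_stretch a b).pow 2

theorem continuous_mapF (a b c : ℂ) : Continuous (mapF a b c) :=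
  (continuous_mapH a b).add continuous_const

theorem contDiff_stretch (a b : ℂ) : ContDiff ℝ ω (stretch a b) := by
  have : stretch a b = stretchCLM a b := funext fun z => (stretchCLM_apply a b z).symm
  rw [this]; exact (stretchCLM a b).contDiff

theorem contDiff_mapH (a b : ℂ) {n : WithTop ℕ∞} : ContDiff ℝ n (mapH a b) :=
  ((contDiff_stretch a b).pow 2).of_le le_top

theorem contDiff_mapF (a b c : ℂ) {n : WithTop ℕ∞} : ContDiff ℝ n (mapF a b c) :=
  (contDiff_mapH a b).add contDiff_const

theorem hasFDerivAt_mapH {a b : ℂ} (hab : ‖b‖ < ‖a‖) (z : ℂ) :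
    HasFDerivAt (mapH a b) (((2 * stretch a b z) • ContinuousLinearMap.id ℝ ℂ) ∘L
      (stretchCLE hab : ℂ →L[ℝ] ℂ)) z := by
  have h1 : HasFDerivAt (stretch a b) (stretchCLE hab : ℂ →L[ℝ] ℂ) z := by
    have : stretch a b = (stretchCLE hab : ℂ →L[ℝ] ℂ) :=
      funext fun z => (stretchCLE_apply hab z).symm
    rw [this]; exact ContinuousLinearMap.hasFDerivAt _
  have h2 : mapH a b = stretch a b * stretch a b := by ext z; simp [mapH, sq]
  rw [h2]
  refine (h1.mul h1).congr_fderiv ?_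
  ext1 v
  simp [two_mul, add_mul]

theorem hasFDerivAt_mapF {a b : ℂ} (hab : ‖b‖ < ‖a‖) (c z : ℂ) :
    HasFDerivAt (mapF a b c) (((2 * stretch a b z) • ContinuousLinearMap.id ℝ ℂ) ∘L
      (stretchCLE hab : ℂ →L[ℝ] ℂ)) z := (hasFDerivAt_mapH hab z).add_const c

/-- The derivative of `mapH` away from the origin as an automorphism of the plane. -/
noncomputable def mapHDeriv {a b z : ℂ} (hab : ‖b‖ < ‖a‖) (hz : z ≠ 0) : ℂ ≃L[ℝ] ℂ :=
  (stretchCLE hab).trans (mulCLE (mul_ne_zero two_ne_zero (stretch_ne_zero hab hz)))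

theorem hasFDerivAt_mapH' {a b z : ℂ} (hab : ‖b‖ < ‖a‖) (hz : z ≠ 0) :
    HasFDerivAt (mapH a b) (mapHDeriv hab hz : ℂ →L[ℝ] ℂ) z := hasFDerivAt_mapH hab z

/-- `mapH` has a continuously differentiable local inverse at every point but the origin. -/
theorem exists_local_inverse_mapH {a b w : ℂ} (hab : ‖b‖ < ‖a‖) (hw : w ≠ 0) :
    ∃ ℓ : ℂ → ℂ, ContDiffAt ℝ 1 ℓ (mapH a b w) ∧
      HasFDerivAt ℓ ((mapHDeriv hab hw).symm : ℂ →L[ℝ] ℂ) (mapH a b w) ∧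
      (∀ᶠ x in 𝓝 w, ℓ (mapH a b x) = x) ∧ ∀ᶠ y in 𝓝 (mapH a b w), mapH a b (ℓ y) = y := by
  have hC : ContDiffAt ℝ 1 (mapH a b) w := (contDiff_mapH a b).contDiffAt
  have hs : HasStrictFDerivAt (mapH a b) (mapHDeriv hab hw : ℂ →L[ℝ] ℂ) w :=
    hC.hasStrictFDerivAt' (hasFDerivAt_mapH' hab hw) one_ne_zero
  exact ⟨hs.localInverse _ _ _, hC.to_localInverse (hasFDerivAt_mapH' hab hw) one_ne_zero,
    hs.to_localInverse.hasFDerivAt, hs.eventually_left_inverse, hs.eventually_right_inverse⟩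

/-- A continuous lift through `mapH` of a `C¹` map is `C¹`. -/
theorem contDiffAt_of_mapH_comp {a b : ℂ} (hab : ‖b‖ < ‖a‖) {σ g : ℂ → ℂ} {z : ℂ}
    (hσ : ContinuousAt σ z) (hz : σ z ≠ 0) (hg : ContDiffAt ℝ 1 g z)
    (h : ∀ᶠ y in 𝓝 z, mapH a b (σ y) = g y) : ContDiffAt ℝ 1 σ z := by
  obtain ⟨ℓ, hℓ, -, hl, -⟩ := exists_local_inverse_mapH hab hz
  have he : σ =ᶠ[𝓝 z] ℓ ∘ g := by
    filter_upwards [hσ.eventually hl, h] with y h1 h2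
    rw [Function.comp_apply, ← h2, h1]
  refine ContDiffAt.congr_of_eventuallyEq ?_ he
  refine ContDiffAt.comp z ?_ hg
  rwa [← h.self_of_nhds]

theorem hasFDerivAt_of_mapH_comp {a b c : ℂ} (hab : ‖b‖ < ‖a‖) {σ g : ℂ → ℂ} {z : ℂ}
    {B : ℂ →L[ℝ] ℂ} (hσ : ContinuousAt σ z) (hz : σ z ≠ 0)
    (hg : HasFDerivAt g B (mapF a b c z))
    (h : ∀ᶠ y in 𝓝 z, mapH a b (σ y) = g (mapF a b c y)) :
    HasFDerivAt σ (conjStep hab (2 * stretch a b (σ z)) (2 * stretch a b z) B) z := by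
  obtain ⟨ℓ, -, hd, hl, -⟩ := exists_local_inverse_mapH hab hz
  have he : σ =ᶠ[𝓝 z] ℓ ∘ g ∘ mapF a b c := by
    filter_upwards [hσ.eventually hl, h] with y h1 h2
    rw [Function.comp_apply, Function.comp_apply, ← h2, h1]
  rw [h.self_of_nhds] at hd
  have := (hd.comp z (hg.comp z (hasFDerivAt_mapF hab c z))).congr_of_eventuallyEq he
  -- The chain rule produces the composition that defines `conjStep`, up to unfolding.
  exact this

/-! ### Continuously differentiable maps are Sobolev maps -/

theorem contDiff_smul_of_tsupport_subset {U : Set ℂ} (hU : IsOpen U) {f : ℂ → ℂ}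
    (hf : ContDiffOn ℝ 1 f U) {φ : ℂ → ℝ} (hφ : ContDiff ℝ ∞ φ) (hs : tsupport φ ⊆ U) :
    ContDiff ℝ 1 (fun z => φ z • f z) := by
  rw [contDiff_iff_contDiffAt]
  intro z
  by_cases hz : z ∈ tsupport φ
  · exact (hφ.contDiffAt.of_le (by exact_mod_cast le_top)).smul
      (hf.contDiffAt (hU.mem_nhds (hs hz)))
  · have h : φ =ᶠ[𝓝 z] 0 := notMem_tsupport_iff_eventuallyEq.1 hz
    refine (contDiffAt_const (c := (0 : ℂ))).congr_of_eventuallyEq ?_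
    filter_upwards [h] with y hy
    simp [hy]

/-- Integration by parts against the constant function 1. -/
theorem integral_fderiv_eq_zero_of_hasCompactSupport {g : ℂ → ℂ} (hg : ContDiff ℝ 1 g)
    (hs : HasCompactSupport g) (v : ℂ) : ∫ z, fderiv ℝ g z v = 0 := by
  have hi : Integrable (fun z => fderiv ℝ g z v) := by
    refine Continuous.integrable_of_hasCompactSupport ?_ (hs.fderiv_apply (𝕜 := ℝ) v)
    exact (hg.continuous_fderiv one_ne_zero).clm_apply continuous_const
  have := integral_bilinear_hasLineDerivAt_right_eq_neg_left_of_integrable (μ := volume)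
    (f := fun _ : ℂ => (1 : ℝ)) (f' := fun _ => 0) (g := g) (g' := fun z => fderiv ℝ g z v)
    (v := v) (B := ContinuousLinearMap.lsmul ℝ ℝ) (by simp) (by simpa using hi)
    (by simpa using hg.continuous.integrable_of_hasCompactSupport hs)
    (fun x _ => by simpa using (hasFDerivAt_const (1 : ℝ) x).hasLineDerivAt v)
    (fun x _ => ((hg.differentiable one_ne_zero) x).hasFDerivAt.hasLineDerivAt v)
  simpa using this

theorem hasWeakFDerivOn_fderiv {U : Set ℂ} (hU : IsOpen U) {f : ℂ → ℂ}
    (hf : ContDiffOn ℝ 1 f U) : HasWeakFDerivOn f (fderiv ℝ f) U := by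
  intro φ hφ hc hs v
  have hg := contDiff_smul_of_tsupport_subset hU hf hφ hs
  have h0 := integral_fderiv_eq_zero_of_hasCompactSupport hg hc.smul_right v
  -- The product rule holds on the whole plane: off the support of `φ` both sides vanish, whatever
  -- value `fderiv ℝ f` takes there.
  have hd : ∀ z, (fderiv ℝ φ z v) • f z + φ z • fderiv ℝ f z v =
      fderiv ℝ (fun z => φ z • f z) z v := by
    intro z
    by_cases hz : z ∈ tsupport φ
    · have h1 : HasFDerivAt φ (fderiv ℝ φ z) z :=
        (hφ.differentiable (by simp) z).hasFDerivAt
      have h2 : HasFDerivAt f (fderiv ℝ f z) z :=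
        ((hf.contDiffAt (hU.mem_nhds (hs hz))).differentiableAt one_ne_zero).hasFDerivAt
      have h3 : fderiv ℝ (fun z => φ z • f z) z = _ := (h1.smul h2).fderiv
      rw [h3]
      simp [add_comm]
    · have h : φ =ᶠ[𝓝 z] 0 := notMem_tsupport_iff_eventuallyEq.1 hz
      have h' : (fun z => φ z • f z) =ᶠ[𝓝 z] 0 := by
        filter_upwards [h] with y hy
        simp [hy]
      rw [h.fderiv_eq, h'.fderiv_eq, h.self_of_nhds]
      simp
  have hd1 : Continuous (fderiv ℝ φ) := hφ.continuous_fderiv (by simp)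
  have i1 : Integrable (fun z => (fderiv ℝ φ z v) • f z) := by
    refine Continuous.integrable_of_hasCompactSupport ?_
      ((hc.fderiv_apply (𝕜 := ℝ) v).smul_right)
    rw [continuous_iff_continuousAt]
    intro z
    by_cases hz : z ∈ tsupport φ
    · exact ((hd1.clm_apply continuous_const).continuousAt).smul
        (hf.continuousOn.continuousAt (hU.mem_nhds (hs hz)))
    · have h : φ =ᶠ[𝓝 z] 0 := notMem_tsupport_iff_eventuallyEq.1 hz
      refine (continuousAt_const (y := (0 : ℂ))).congr ?_
      filter_upwards [h.fderiv (𝕜 := ℝ)] with y hy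
      simp [hy]
  have i2 : Integrable (fun z => φ z • fderiv ℝ f z v) := by
    have i3 : Integrable (fun z => fderiv ℝ (fun z => φ z • f z) z v) :=
      ((hg.continuous_fderiv one_ne_zero).clm_apply
        continuous_const).integrable_of_hasCompactSupport
          ((hc.smul_right (f' := f)).fderiv_apply (𝕜 := ℝ) v)
    refine (i3.sub i1).congr (Eventually.of_forall fun z => ?_)
    simp only [Pi.sub_apply, ← hd, add_sub_cancel_left]
  rw [eq_neg_iff_add_eq_zero, ← integral_add i1 i2, ← h0]
  exact integral_congr_ae (Eventually.of_forall hd)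

theorem memLp_two_of_continuousOn {E : Type*} [NormedAddCommGroup E]
    [SecondCountableTopologyEither ℂ E] {f : ℂ → E} {C : Set ℂ} (hC : IsCompact C)
    (hf : ContinuousOn f C) : MemLp f 2 (volume.restrict C) := by
  obtain ⟨B, hB⟩ := hC.exists_bound_of_continuousOn hf
  have : IsFiniteMeasure (volume.restrict C) := ⟨by simpa using hC.measure_lt_top⟩
  exact MemLp.of_bound (hf.aestronglyMeasurable_of_isCompact hC hC.measurableSet) B
    (ae_restrict_of_forall_mem hC.measurableSet hB)

theorem isQuasiconformalOn_of_contDiffOn {U : Set ℂ} (hU : IsOpen U) {f : ℂ → ℂ}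
    (hinj : Set.InjOn f U) (hf : ContDiffOn ℝ 1 f U) {K : ℝ} (hK : 1 ≤ K)
    (hd : ∀ z ∈ U, ‖fderiv ℝ f z‖ ^ 2 ≤ K * (fderiv ℝ f z).det) : IsQuasiconformalOn f U :=
  ⟨hinj, K, hK, hU, hf.continuousOn, fderiv ℝ f, hasWeakFDerivOn_fderiv hU hf,
    fun _ hC hCU => ⟨memLp_two_of_continuousOn hC (hf.continuousOn.mono hCU),
      memLp_two_of_continuousOn hC ((hf.continuousOn_fderiv_of_isOpen hU le_rfl).mono hCU)⟩,
    ae_restrict_of_forall_mem hU.measurableSet hd⟩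

/-! ### Radial sets -/

/-- A set which is closed under dilations by factors at least one. -/
def IsRadial (S : Set ℂ) : Prop := ∀ z ∈ S, ∀ t : ℝ, 1 ≤ t → (t : ℂ) * z ∈ S

theorem isPreconnected_norm_gt {r : ℝ} (hr : 0 < r) : IsPreconnected {z : ℂ | r < ‖z‖} := by
  have h : {z : ℂ | r < ‖z‖} = Complex.exp '' {w : ℂ | Real.log r < w.re} := by
    ext z
    simp only [Set.mem_ofPred_eq, Set.mem_image]
    constructor
    · intro hz
      have hz0 : z ≠ 0 := norm_pos_iff.1 (hr.trans hz)
      exact ⟨Complex.log z, by rw [Complex.log_re]; exact Real.log_lt_log hr hz,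
        Complex.exp_log hz0⟩
    · rintro ⟨w, hw, rfl⟩
      rw [Complex.norm_exp]
      exact (Real.log_lt_iff_lt_exp hr).1 hw
  rw [h]
  exact (convex_halfSpace_re_gt _).isPreconnected.image _ Complex.continuous_exp.continuousOn

/-- Every point is joined inside `S`, by its outward ray, to the connected exterior of a disc. -/
theorem IsRadial.isPreconnected {S : Set ℂ} (hS : IsRadial S) (h0 : (0 : ℂ) ∉ S) {r : ℝ}
    (hr : 0 < r) (hrS : {z : ℂ | r < ‖z‖} ⊆ S) : IsPreconnected S := by
  have hray : ∀ z ∈ S, ∃ T ⊆ S, z ∈ T ∧ (∃ w ∈ T, r < ‖w‖) ∧ IsPreconnected T := by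
    intro z hz
    have hz0 : 0 < ‖z‖ := norm_pos_iff.2 fun h => h0 (h ▸ hz)
    refine ⟨(fun t : ℝ => (t : ℂ) * z) '' Set.Ici 1, ?_, ⟨1, by simp, by simp⟩,
      ⟨_, ⟨1 + r / ‖z‖, ?_, rfl⟩, ?_⟩, isPreconnected_Ici.image _ (by fun_prop)⟩
    · rintro _ ⟨t, ht, rfl⟩
      exact hS z hz t ht
    · simp only [Set.mem_Ici]
      have : 0 < r / ‖z‖ := by positivity
      linarith
    · have h1 : 0 < 1 + r / ‖z‖ := by positivity
      rw [norm_mul, Complex.norm_real, Real.norm_of_nonneg h1.le, add_mul,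
        div_mul_cancel₀ _ hz0.ne']
      linarith
  have hbig : ((r + 1 : ℝ) : ℂ) ∈ {z : ℂ | r < ‖z‖} := by
    simp only [Set.mem_ofPred_eq, Complex.norm_real]
    exact (lt_add_one r).trans_le (le_abs_self _)
  refine isPreconnected_of_forall ((r + 1 : ℝ) : ℂ) fun z hz => ?_
  obtain ⟨T, hTS, hzT, ⟨w, hwT, hw⟩, hT⟩ := hray z hz
  exact ⟨T ∪ {z : ℂ | r < ‖z‖}, Set.union_subset hTS hrS, Or.inr hbig, Or.inl hzT,
    hT.union w hwT hw (isPreconnected_norm_gt hr)⟩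

/-! ### Square roots along homotopies -/

open unitInterval in
-- The quotient `G (t, x) / G (0, x)` starts at 1, so homotopy lifting through the covering `exp`
-- gives it a logarithm starting at 0. Half of that logarithm transports the given root `s₀` from
-- time 0 to time 1.
theorem exists_continuous_sqrt_of_homotopy {A : Type*} [TopologicalSpace A] (G : I × A → ℂ)
    (hG : Continuous G) (hne : ∀ p, G p ≠ 0) (s₀ : A → ℂ) (hs₀ : Continuous s₀)
    (hsq : ∀ x, s₀ x ^ 2 = G (0, x)) :
    ∃ s : A → ℂ, Continuous s ∧ (∀ x, s x ^ 2 = G (1, x)) ∧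
      ∀ x, (∀ t, G (t, x) = G (0, x)) → s x = s₀ x := by
  have hcont : Continuous fun p : I × A => G p / G (0, p.2) :=
    hG.div (by fun_prop) fun p => hne _
  let Q : C(I × A, {z : ℂ // z ≠ 0}) :=
    ⟨fun p => ⟨G p / G (0, p.2), div_ne_zero (hne _) (hne _)⟩, hcont.subtype_mk _⟩
  have h0 : ∀ x, Q (0, x) = (fun z : ℂ ↦ (⟨_, z.exp_ne_zero⟩ : {z : ℂ // z ≠ 0}))
      ((ContinuousMap.const A (0 : ℂ)) x) := by
    intro x
    apply Subtype.ext
    simp [Q, div_self (hne (0, x))]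
  let Λ := Complex.isCoveringMap_exp.liftHomotopy Q (ContinuousMap.const A 0) h0
  have hΛ : ∀ p, Complex.exp (Λ p) = G p / G (0, p.2) := fun p =>
    congrArg Subtype.val (congrFun (Complex.isCoveringMap_exp.liftHomotopy_lifts Q _ h0) p)
  have hΛ0 : ∀ x, Λ (0, x) = 0 := Complex.isCoveringMap_exp.liftHomotopy_zero Q _ h0
  have hexp : ∀ p, Complex.exp (Λ p / 2) ^ 2 = G p / G (0, p.2) := by
    intro p
    rw [← hΛ, ← Complex.exp_nat_mul]
    congr 1
    push_cast
    ring
  refine ⟨fun x => s₀ x * Complex.exp (Λ (1, x) / 2), by fun_prop, fun x => ?_, fun x hx => ?_⟩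
  · rw [mul_pow, hsq, hexp]
    exact mul_div_cancel₀ _ (hne _)
  -- For a stationary path the transporting factor has square 1 and starts at 1, so it stays 1 on
  -- the connected interval.
  · have h1 : Set.EqOn (fun t : I => Complex.exp (Λ (t, x) / 2)) (fun _ => 1) Set.univ := by
      refine isPreconnected_univ.eq_of_sq_eq (by fun_prop) (by fun_prop) ?_ (by simp)
        (Set.mem_univ 0) (by simp [hΛ0])
      intro t _
      simp [hexp, hx t, div_self (hne (0, x))]
    have := h1 (Set.mem_univ 1)
    simp only at this ⊢
    rw [this, mul_one]

/-! ### Conjugacies near infinity -/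

/-- The linear dilatation of `stretch a b`. -/
noncomputable def dilatation (a b : ℂ) : ℝ := (‖a‖ + ‖b‖) / (‖a‖ - ‖b‖)

theorem one_le_dilatation {a b : ℂ} (hab : ‖b‖ < ‖a‖) : 1 ≤ dilatation a b := by
  rw [dilatation, one_le_div (sub_pos.2 hab)]
  linarith [norm_nonneg b]

/-- Successive lifts conjugating `mapF a b p` to `mapF a b q` near infinity. -/
noncomputable def conjSeq (a b p q : ℂ) : ℕ → ℂ → ℂ
  | 0, z => z
  | k + 1, z => stretchInv a b
      (stretch a b z *
        Complex.exp (Complex.log ((conjSeq a b p q k (mapF a b p z) - q) / stretch a b z ^ 2) / 2))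

theorem conjSeq_zero_right (a b c : ℂ) (k : ℕ) (z : ℂ) :
    conjSeq a b c 0 k z = bottcherSeq a b c k z := by
  induction k generalizing z with
  | zero => rfl
  | succ k ih => rw [conjSeq, bottcherSeq, ih, sub_zero]

/-- The requirements on a radius outside which the lifts `conjSeq a b p q` converge. -/
structure IsLargeRadius (a b p q : ℂ) (R : ℝ) : Prop where
  four_le : 4 ≤ R
  le_radius : 16 * dilatation a b ^ 2 ≤ R
  growth : ∀ z, R ≤ ‖z‖ → 8 * dilatation a b * ‖z‖ ≤ ‖mapF a b p z‖
  sq_large : ∀ z, R ≤ ‖z‖ → 2 * (‖p‖ + ‖q‖ + 1) ≤ ‖stretch a b z‖ ^ 2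
  lin_large : ∀ z, R ≤ ‖z‖ → ‖p‖ + ‖q‖ + 1 ≤ (‖a‖ - ‖b‖) * ‖stretch a b z‖
  stretch_large : ∀ z, R ≤ ‖z‖ → 2 * (‖a‖ + ‖b‖) ≤ ‖stretch a b z‖
  expand : ∀ x y, R - 1 ≤ ‖x‖ → ‖x - y‖ ≤ 2 → 2 * ‖x - y‖ ≤ ‖mapH a b x - mapH a b y‖

theorem eventually_isLargeRadius {a b : ℂ} (hab : ‖b‖ < ‖a‖) (p q : ℂ) :
    ∀ᶠ R in atTop, IsLargeRadius a b p q R := by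
  have hm := sub_pos.2 hab
  set m := ‖a‖ - ‖b‖ with hm_def
  set M := ‖a‖ + ‖b‖ with hM_def
  -- Every requirement reduces to a lower bound on a positive multiple of `R`, because `|h z| ≥ m
  -- |z|`.
  have hlin : ∀ k > 0, ∀ y : ℝ, ∀ᶠ R : ℝ in atTop, y ≤ k * R := fun k hk y =>
    (tendsto_id.const_mul_atTop hk).eventually_ge_atTop y
  filter_upwards [eventually_ge_atTop 4, eventually_ge_atTop (16 * dilatation a b ^ 2),
    hlin (m ^ 2) (by positivity) (8 * dilatation a b + ‖p‖),
    hlin (m ^ 2) (by positivity) (2 * (‖p‖ + ‖q‖ + 1)), hlin m hm (2 * M),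
    hlin (2 * m ^ 2) (by positivity) (2 + 2 * m * M + 2 * m ^ 2)] with R h4 h16 hg hs hl he
  have hR : ∀ z : ℂ, R ≤ ‖z‖ → m * R ≤ ‖stretch a b z‖ := fun z hz =>
    (mul_le_mul_of_nonneg_left hz hm.le).trans (le_norm_stretch a b z)
  refine ⟨h4, h16, fun z hz => ?_, fun z hz => ?_, fun z hz => ?_, fun z hz => ?_,
    fun x y hx hxy => ?_⟩
  · have h1 : ‖mapH a b z‖ - ‖p‖ ≤ ‖mapF a b p z‖ := by
      have := norm_sub_le (mapF a b p z) p
      rw [mapF, add_sub_cancel_right] at this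
      rw [mapF]; linarith
    have h2 : (m * ‖z‖) ^ 2 ≤ ‖mapH a b z‖ := by
      rw [mapH, norm_pow]
      gcongr
      exact le_norm_stretch a b z
    have hz1 : 4 ≤ ‖z‖ := h4.trans hz
    have h3 : (8 * dilatation a b + ‖p‖) * ‖z‖ ≤ m ^ 2 * ‖z‖ * ‖z‖ := by
      refine mul_le_mul_of_nonneg_right (hg.trans ?_) (norm_nonneg z)
      gcongr
    nlinarith [norm_nonneg p]
  · calc 2 * (‖p‖ + ‖q‖ + 1) ≤ m ^ 2 * R := hs
      _ ≤ (m * R) ^ 2 := by rw [mul_pow]; gcongr; nlinarith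
      _ ≤ _ := by gcongr; exact hR z hz
  · calc ‖p‖ + ‖q‖ + 1 ≤ 2 * (‖p‖ + ‖q‖ + 1) := by linarith [norm_nonneg p, norm_nonneg q]
      _ ≤ m * (m * R) := by rw [← mul_assoc, ← sq]; exact hs
      _ ≤ _ := by gcongr; exact hR z hz
  · exact hl.trans (hR z hz)
  · have h1 : mapH a b x - mapH a b y =
        stretch a b (x - y) * (2 * stretch a b x - stretch a b (x - y)) := by
      rw [mapH, mapH, stretch_sub]; ring
    have h2 : m * (R - 1) ≤ ‖stretch a b x‖ :=
      (mul_le_mul_of_nonneg_left hx hm.le).trans (le_norm_stretch a b x)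
    have h3 : ‖stretch a b (x - y)‖ ≤ M * 2 :=
      (norm_stretch_le a b _).trans (by gcongr)
    have h4 : 2 * (m * (R - 1)) - M * 2 ≤ ‖2 * stretch a b x - stretch a b (x - y)‖ := by
      have := norm_sub_norm_le (2 * stretch a b x) (stretch a b (x - y))
      rw [norm_mul, Complex.norm_ofNat] at this
      linarith
    have h5 : 2 ≤ m * (2 * (m * (R - 1)) - M * 2) := by linarith
    have h6 : 0 ≤ 2 * (m * (R - 1)) - M * 2 := by
      by_contra h
      push Not at h
      nlinarith
    rw [h1, norm_mul]
    calc 2 * ‖x - y‖ ≤ m * (2 * (m * (R - 1)) - M * 2) * ‖x - y‖ := by gcongr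
      _ = (m * ‖x - y‖) * (2 * (m * (R - 1)) - M * 2) := by ring
      _ ≤ _ := by
        gcongr
        exact le_norm_stretch a b _

/-- The principal root `s` has nonnegative real part, hence `|s + 1| ≥ 1`, and `u - 1 = (s - 1) (s +
1)`. -/
theorem norm_exp_half_log_sub_one_le {u : ℂ} (hu : ‖u - 1‖ ≤ 1 / 2) :
    Complex.exp (Complex.log u / 2) ^ 2 = u ∧
      ‖Complex.exp (Complex.log u / 2) - 1‖ ≤ ‖u - 1‖ := by
  have hu0 : u ≠ 0 := by
    rintro rfl
    norm_num at hu
  have hsq : Complex.exp (Complex.log u / 2) ^ 2 = u := by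
    rw [← Complex.exp_nat_mul]
    push_cast
    rw [mul_div_cancel₀ _ two_ne_zero, Complex.exp_log hu0]
  refine ⟨hsq, ?_⟩
  set s := Complex.exp (Complex.log u / 2) with hs
  have hre : 0 ≤ s.re := by
    rw [hs, Complex.exp_re]
    refine mul_nonneg (Real.exp_pos _).le (Real.cos_nonneg_of_mem_Icc ?_)
    have h1 := Complex.neg_pi_lt_log_im u
    have h2 := Complex.log_im_le_pi u
    have h3 : (Complex.log u / 2).im = (Complex.log u).im / 2 := by
      simp
    rw [h3]
    constructor <;> linarith
  have h1 : 1 ≤ ‖s + 1‖ := by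
    refine le_trans ?_ (Complex.re_le_norm _)
    simpa using hre
  have h2 : u - 1 = (s - 1) * (s + 1) := by rw [← hsq]; ring
  rw [h2, norm_mul]
  exact le_mul_of_one_le_right (norm_nonneg _) h1

/-! ### Convergence of the lifts outside a large disc -/

namespace IsLargeRadius

variable {a b p q : ℂ} {R : ℝ}

theorem le_norm_mapF (hR : IsLargeRadius a b p q R) (hab : ‖b‖ < ‖a‖) {z : ℂ} (hz : R ≤ ‖z‖) :
    2 * ‖z‖ ≤ ‖mapF a b p z‖ := by
  refine le_trans ?_ (hR.growth z hz)
  have := one_le_dilatation hab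
  gcongr
  linarith

theorem mapF_mem (hR : IsLargeRadius a b p q R) (hab : ‖b‖ < ‖a‖) {z : ℂ} (hz : R ≤ ‖z‖) :
    R ≤ ‖mapF a b p z‖ := by
  have := hR.le_norm_mapF hab hz
  linarith [norm_nonneg z]

theorem mapF_mem' (hR : IsLargeRadius a b p q R) (hab : ‖b‖ < ‖a‖) {z : ℂ} (hz : R < ‖z‖) :
    R < ‖mapF a b p z‖ := by
  have := hR.le_norm_mapF hab hz.le
  linarith [norm_nonneg z]

theorem ne_zero (hR : IsLargeRadius a b p q R) {z : ℂ} (hz : R ≤ ‖z‖ + 1) : z ≠ 0 := by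
  rintro rfl
  have := hR.four_le
  rw [norm_zero] at hz
  linarith

theorem ratio_near_one (hR : IsLargeRadius a b p q R) (hab : ‖b‖ < ‖a‖) {z w : ℂ}
    (hz : R ≤ ‖z‖) (hw : ‖w - mapF a b p z‖ ≤ 1) :
    ‖(w - q) / stretch a b z ^ 2 - 1‖ ≤ (‖p‖ + ‖q‖ + 1) / ‖stretch a b z‖ ^ 2 := by
  have hs : stretch a b z ^ 2 ≠ 0 :=
    pow_ne_zero 2 (stretch_ne_zero hab (hR.ne_zero (by linarith)))
  have h1 : (w - q) / stretch a b z ^ 2 - 1 =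
      ((w - mapF a b p z) + p - q) / stretch a b z ^ 2 := by
    rw [eq_div_iff hs, sub_mul, div_mul_cancel₀ _ hs, mapF, mapH]; ring
  rw [h1, norm_div, norm_pow]
  gcongr
  have h2 := norm_sub_le ((w - mapF a b p z) + p) q
  have h3 := norm_add_le (w - mapF a b p z) p
  linarith

theorem ratio_half (hR : IsLargeRadius a b p q R) (hab : ‖b‖ < ‖a‖) {z w : ℂ}
    (hz : R ≤ ‖z‖) (hw : ‖w - mapF a b p z‖ ≤ 1) :
    ‖(w - q) / stretch a b z ^ 2 - 1‖ ≤ 1 / 2 := by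
  refine (hR.ratio_near_one hab hz hw).trans ?_
  have h1 := hR.sq_large z hz
  have hs : 0 < ‖stretch a b z‖ :=
    norm_pos_iff.2 (stretch_ne_zero hab (hR.ne_zero (by linarith)))
  rw [div_le_div_iff₀ (by positivity) two_pos]
  linarith

/-- An error of at most 1 at `f z`, together with the constants `p` and `q`, becomes after the
square root an error of order `1 / |h z|`, which `lin_large` makes at most 1 again. -/
theorem norm_conjSeq_sub_le (hR : IsLargeRadius a b p q R) (hab : ‖b‖ < ‖a‖) (k : ℕ) {z : ℂ}
    (hz : R ≤ ‖z‖) : ‖conjSeq a b p q k z - z‖ ≤ 1 := by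
  induction k generalizing z with
  | zero => simp [conjSeq]
  | succ k ih =>
    have hm := sub_pos.2 hab
    have hw := ih (hR.mapF_mem hab hz)
    have h1 := hR.ratio_near_one hab hz hw
    have h2 := (norm_exp_half_log_sub_one_le (hR.ratio_half hab hz hw)).2
    have hs : 0 < ‖stretch a b z‖ :=
      norm_pos_iff.2 (stretch_ne_zero hab (hR.ne_zero (by linarith)))
    have hz' : ∀ s, stretchInv a b (stretch a b z * s) - z =
        stretchInv a b (stretch a b z * (s - 1)) := fun s => by
      rw [mul_sub_one, stretchInv_sub hab, stretchInv_stretch hab]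
    rw [conjSeq, hz']
    refine (norm_stretchInv_le hab _).trans ?_
    rw [div_le_one hm, norm_mul]
    calc _ ≤ ‖stretch a b z‖ * ((‖p‖ + ‖q‖ + 1) / ‖stretch a b z‖ ^ 2) := by
          gcongr; exact h2.trans h1
      _ = (‖p‖ + ‖q‖ + 1) / ‖stretch a b z‖ := by field_simp
      _ ≤ ‖a‖ - ‖b‖ := by rw [div_le_iff₀ hs]; exact hR.lin_large z hz

theorem mapH_conjSeq (hR : IsLargeRadius a b p q R) (hab : ‖b‖ < ‖a‖) (k : ℕ) {z : ℂ}
    (hz : R ≤ ‖z‖) :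
    mapH a b (conjSeq a b p q (k + 1) z) = conjSeq a b p q k (mapF a b p z) - q := by
  have hw := hR.norm_conjSeq_sub_le hab k (hR.mapF_mem hab hz)
  have hs : stretch a b z ≠ 0 := stretch_ne_zero hab (hR.ne_zero (by linarith))
  rw [mapH, conjSeq, stretch_stretchInv hab, mul_pow,
    (norm_exp_half_log_sub_one_le (hR.ratio_half hab hz hw)).1]
  field_simp

/-- Applying `H` to two consecutive lifts at `z` gives, up to the constant `q`, the previous two at
`f z`. Both lifts lie within 1 of `z`, where `H` at least doubles their distance, so each level
halves the difference. -/
theorem norm_conjSeq_succ_sub_le (hR : IsLargeRadius a b p q R) (hab : ‖b‖ < ‖a‖) (k : ℕ)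
    {z : ℂ} (hz : R ≤ ‖z‖) :
    ‖conjSeq a b p q (k + 1) z - conjSeq a b p q k z‖ ≤ (1 / 2) ^ k := by
  induction k generalizing z with
  | zero => simpa [conjSeq] using hR.norm_conjSeq_sub_le hab 1 hz
  | succ k ih =>
    have h1 := hR.norm_conjSeq_sub_le hab (k + 1 + 1) hz
    have h2 := hR.norm_conjSeq_sub_le hab (k + 1) hz
    have h3 : R - 1 ≤ ‖conjSeq a b p q (k + 1 + 1) z‖ := by
      have := norm_sub_norm_le z (conjSeq a b p q (k + 1 + 1) z)
      rw [norm_sub_rev] at this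
      linarith
    have h4 : ‖conjSeq a b p q (k + 1 + 1) z - conjSeq a b p q (k + 1) z‖ ≤ 2 := by
      have := norm_sub_le (conjSeq a b p q (k + 1 + 1) z - z) (conjSeq a b p q (k + 1) z - z)
      rw [sub_sub_sub_cancel_right] at this
      linarith
    have h5 := hR.expand _ _ h3 h4
    rw [hR.mapH_conjSeq hab _ hz, hR.mapH_conjSeq hab _ hz, sub_sub_sub_cancel_right] at h5
    have h6 := ih (hR.mapF_mem hab hz)
    rw [pow_succ]
    linarith

end IsLargeRadius

/-- The limit of the lifts `conjSeq`. -/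
noncomputable def conjLim (a b p q z : ℂ) : ℂ := limUnder atTop fun k => conjSeq a b p q k z

namespace IsLargeRadius

variable {a b p q : ℂ} {R : ℝ}

theorem tendsto_conjSeq (hR : IsLargeRadius a b p q R) (hab : ‖b‖ < ‖a‖) {z : ℂ}
    (hz : R ≤ ‖z‖) : Tendsto (fun k => conjSeq a b p q k z) atTop (𝓝 (conjLim a b p q z)) := by
  refine (cauchySeq_of_le_geometric (1 / 2) 1 (by norm_num) fun k => ?_).tendsto_limUnder
  rw [dist_comm, dist_eq_norm, one_mul]
  exact hR.norm_conjSeq_succ_sub_le hab k hz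

theorem norm_conjLim_sub_le (hR : IsLargeRadius a b p q R) (hab : ‖b‖ < ‖a‖) {z : ℂ}
    (hz : R ≤ ‖z‖) : ‖conjLim a b p q z - z‖ ≤ 1 :=
  le_of_tendsto ((hR.tendsto_conjSeq hab hz).sub_const z).norm
    (Eventually.of_forall fun k => hR.norm_conjSeq_sub_le hab k hz)

theorem mapF_conjLim (hR : IsLargeRadius a b p q R) (hab : ‖b‖ < ‖a‖) {z : ℂ}
    (hz : R ≤ ‖z‖) : mapF a b q (conjLim a b p q z) = conjLim a b p q (mapF a b p z) := by
  have h1 := (hR.tendsto_conjSeq hab (hR.mapF_mem hab hz))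
  have h2 := ((continuous_mapF a b q).tendsto _).comp
    ((tendsto_add_atTop_iff_nat 1).2 (hR.tendsto_conjSeq hab hz))
  refine tendsto_nhds_unique h2 (h1.congr fun k => ?_)
  simp [mapF, hR.mapH_conjSeq hab k hz]

theorem tendstoUniformlyOn_conjSeq (hR : IsLargeRadius a b p q R) (hab : ‖b‖ < ‖a‖) :
    TendstoUniformlyOn (conjSeq a b p q) (conjLim a b p q) atTop {z | R < ‖z‖} := by
  rw [Metric.tendstoUniformlyOn_iff]
  intro ε hε
  have h0 : Tendsto (fun k : ℕ => 1 * (1 / 2 : ℝ) ^ k / (1 - 1 / 2)) atTop (𝓝 0) := by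
    have := ((tendsto_pow_atTop_nhds_zero_of_lt_one (r := (1 / 2 : ℝ)) (by norm_num)
      (by norm_num)).const_mul 1).div_const (1 - 1 / 2)
    simpa using this
  filter_upwards [h0.eventually (gt_mem_nhds hε)] with k hk z hz
  rw [dist_comm]
  refine lt_of_le_of_lt (dist_le_of_le_geometric_of_tendsto (1 / 2) 1 (by norm_num)
    (fun k => ?_) (hR.tendsto_conjSeq hab (le_of_lt hz)) k) hk
  rw [dist_comm, dist_eq_norm, one_mul]
  exact hR.norm_conjSeq_succ_sub_le hab k (le_of_lt hz)

end IsLargeRadius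

/-! ### Derivatives of the conjugacies near infinity -/

theorem conjStep_self {a b u : ℂ} (hab : ‖b‖ < ‖a‖) (hu : u ≠ 0) :
    conjStep hab u u (ContinuousLinearMap.id ℝ ℂ) = ContinuousLinearMap.id ℝ ℂ := by
  ext1 z
  rw [conjStep_apply, ContinuousLinearMap.id_apply, inv_mul_cancel_left₀ hu,
    stretchInv_stretch hab, ContinuousLinearMap.id_apply]

/-- The identity is `conjStep hab u u id`, and `conjStep` is additive in `B` and in `v`, so the
difference splits into one term for `B - id` and one for `v - u`. -/
theorem norm_conjStep_sub_id_le {a b u v : ℂ} (hab : ‖b‖ < ‖a‖) (hu : u ≠ 0)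
    (B : ℂ →L[ℝ] ℂ) : ‖conjStep hab u v B - ContinuousLinearMap.id ℝ ℂ‖ ≤ dilatation a b *
      (‖u⁻¹‖ * ‖v‖ * ‖B - ContinuousLinearMap.id ℝ ℂ‖ + ‖u⁻¹‖ * ‖v - u‖) := by
  have h : conjStep hab u v B - ContinuousLinearMap.id ℝ ℂ =
      conjStep hab u v (B - ContinuousLinearMap.id ℝ ℂ) +
        conjStep hab u (v - u) (ContinuousLinearMap.id ℝ ℂ) := by
    nth_rewrite 1 [← conjStep_self hab hu]
    ext1 z
    simp only [sub_apply, add_apply, conjStep_apply, ContinuousLinearMap.id_apply,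
      ← stretchCLE_symm_apply hab, ← map_sub, ← map_add]
    congr 1
    ring
  rw [h, mul_add]
  refine (norm_add_le _ _).trans (add_le_add (norm_conjStep_le hab _ _ _) ?_)
  refine (norm_conjStep_le hab _ _ _).trans ?_
  have := one_le_dilatation hab
  rw [← dilatation]
  exact mul_le_mul_of_nonneg_left
    (mul_le_of_le_one_right (by positivity) ContinuousLinearMap.norm_id_le) (by linarith)

theorem norm_conjStep_sub_conjStep_le {a b : ℂ} (hab : ‖b‖ < ‖a‖) (u₁ u₂ v : ℂ)
    (B₁ B₂ : ℂ →L[ℝ] ℂ) : ‖conjStep hab u₁ v B₁ - conjStep hab u₂ v B₂‖ ≤ dilatation a b *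
      (‖u₁⁻¹‖ * ‖v‖ * ‖B₁ - B₂‖ + ‖u₁⁻¹ - u₂⁻¹‖ * ‖v‖ * ‖B₂‖) := by
  -- `conjStep` depends on `u` through `u⁻¹`, hence the parameter `(u₁⁻¹ - u₂⁻¹)⁻¹`; with `0⁻¹ = 0`
  -- this is correct even if `u₁ = u₂`.
  have h : conjStep hab u₁ v B₁ - conjStep hab u₂ v B₂ =
      conjStep hab u₁ v (B₁ - B₂) + conjStep hab (u₁⁻¹ - u₂⁻¹)⁻¹ v B₂ := by
    ext1 z
    simp only [sub_apply, add_apply, conjStep_apply, inv_inv,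
      ← stretchCLE_symm_apply hab, ← map_sub, ← map_add]
    congr 1
    ring
  rw [h, mul_add]
  refine (norm_add_le _ _).trans (add_le_add (norm_conjStep_le hab _ _ _) ?_)
  refine (norm_conjStep_le hab _ _ _).trans ?_
  rw [inv_inv, dilatation]

namespace IsLargeRadius

variable {a b p q : ℂ} {R : ℝ}

theorem isOpen_norm_gt (R : ℝ) : IsOpen {z : ℂ | R < ‖z‖} :=
  isOpen_lt continuous_const continuous_norm

theorem conjSeq_ne_zero (hR : IsLargeRadius a b p q R) (hab : ‖b‖ < ‖a‖) (k : ℕ) {z : ℂ}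
    (hz : R ≤ ‖z‖) : conjSeq a b p q k z ≠ 0 := by
  apply hR.ne_zero
  have h1 := hR.norm_conjSeq_sub_le hab k hz
  have := norm_sub_norm_le z (conjSeq a b p q k z)
  rw [norm_sub_rev] at this
  linarith

theorem continuousOn_conjSeq (hR : IsLargeRadius a b p q R) (hab : ‖b‖ < ‖a‖) (k : ℕ) :
    ContinuousOn (conjSeq a b p q k) {z | R < ‖z‖} := by
  induction k with
  | zero => exact continuousOn_id
  | succ k ih =>
    have hc : ContinuousOn (fun z => (conjSeq a b p q k (mapF a b p z) - q) / stretch a b z ^ 2)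
        {z | R < ‖z‖} := by
      refine ContinuousOn.div (ContinuousOn.sub (ih.comp (continuous_mapF a b p).continuousOn
        fun z hz => hR.mapF_mem' hab hz) continuousOn_const)
        ((continuous_stretch a b).pow 2).continuousOn fun z hz => ?_
      exact pow_ne_zero 2 (stretch_ne_zero hab (hR.ne_zero (by linarith [Set.mem_ofPred.1 hz])))
    refine (continuous_stretchInv hab).comp_continuousOn
      ((continuous_stretch a b).continuousOn.mul (Complex.continuous_exp.comp_continuousOn
        ((hc.clog fun z hz => ?_).div_const 2)))
    have h1 := hR.ratio_half hab (le_of_lt hz)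
      (hR.norm_conjSeq_sub_le hab k (hR.mapF_mem hab (le_of_lt hz)))
    left
    have h2 := (abs_le.1 ((Complex.abs_re_le_norm _).trans h1)).1
    rw [Complex.sub_re, Complex.one_re] at h2
    linarith

theorem eventually_mapH_conjSeq (hR : IsLargeRadius a b p q R) (hab : ‖b‖ < ‖a‖) (k : ℕ)
    {z : ℂ} (hz : R < ‖z‖) : ∀ᶠ y in 𝓝 z,
      mapH a b (conjSeq a b p q (k + 1) y) = conjSeq a b p q k (mapF a b p y) - q := by
  filter_upwards [(isOpen_norm_gt R).mem_nhds hz] with y hy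
  exact hR.mapH_conjSeq hab k (le_of_lt hy)

theorem contDiffOn_conjSeq (hR : IsLargeRadius a b p q R) (hab : ‖b‖ < ‖a‖) (k : ℕ) :
    ContDiffOn ℝ 1 (conjSeq a b p q k) {z | R < ‖z‖} := by
  induction k with
  | zero => exact contDiffOn_id
  | succ k ih =>
    intro z hz
    refine ContDiffAt.contDiffWithinAt (contDiffAt_of_mapH_comp hab
      ((hR.continuousOn_conjSeq hab (k + 1)).continuousAt ((isOpen_norm_gt R).mem_nhds hz))
      (hR.conjSeq_ne_zero hab (k + 1) (le_of_lt hz)) ?_ (hR.eventually_mapH_conjSeq hab k hz))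
    exact ((ih.contDiffAt ((isOpen_norm_gt R).mem_nhds (hR.mapF_mem' hab hz))).comp z
      (contDiff_mapF a b p).contDiffAt).sub contDiffAt_const

theorem fderiv_conjSeq_succ (hR : IsLargeRadius a b p q R) (hab : ‖b‖ < ‖a‖) (k : ℕ)
    {z : ℂ} (hz : R < ‖z‖) : fderiv ℝ (conjSeq a b p q (k + 1)) z =
      conjStep hab (2 * stretch a b (conjSeq a b p q (k + 1) z)) (2 * stretch a b z)
        (fderiv ℝ (conjSeq a b p q k) (mapF a b p z)) := by
  have hg : HasFDerivAt (conjSeq a b p q k) (fderiv ℝ (conjSeq a b p q k) (mapF a b p z))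
      (mapF a b p z) := (((hR.contDiffOn_conjSeq hab k).contDiffAt
    ((isOpen_norm_gt R).mem_nhds (hR.mapF_mem' hab hz))).differentiableAt one_ne_zero).hasFDerivAt
  exact (hasFDerivAt_of_mapH_comp (g := fun w => conjSeq a b p q k w - q) hab
    ((hR.continuousOn_conjSeq hab (k + 1)).continuousAt ((isOpen_norm_gt R).mem_nhds hz))
    (hR.conjSeq_ne_zero hab (k + 1) (le_of_lt hz)) (hg.sub_const q)
    (hR.eventually_mapH_conjSeq hab k hz)).fderiv

/-- The scalar factors entering the derivative of a lift. -/
theorem factor_bounds (hR : IsLargeRadius a b p q R) (hab : ‖b‖ < ‖a‖) {z w : ℂ}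
    (hz : R < ‖z‖) (hw : ‖w - z‖ ≤ 1) : stretch a b w ≠ 0 ∧
      ‖(2 * stretch a b w)⁻¹‖ * ‖2 * stretch a b z‖ ≤ 2 ∧
      ‖(2 * stretch a b w)⁻¹‖ * ((‖a‖ + ‖b‖) * ‖z‖) ≤ dilatation a b := by
  have hm := sub_pos.2 hab
  have hl := hR.stretch_large z hz.le
  have hz0 : 0 < ‖z‖ := norm_pos_iff.2 (hR.ne_zero (by linarith))
  have hsz : 0 < ‖stretch a b z‖ := norm_pos_iff.2 (stretch_ne_zero hab (norm_pos_iff.1 hz0))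
  have h1 : ‖stretch a b z‖ - ‖stretch a b w‖ ≤ ‖a‖ + ‖b‖ := by
    refine (norm_sub_norm_le _ _).trans ?_
    rw [← stretch_sub, ← norm_neg, ← stretch_neg, neg_sub]
    refine (norm_stretch_le a b _).trans (mul_le_of_le_one_right (by positivity) hw)
  have h2 : ‖stretch a b z‖ ≤ 2 * ‖stretch a b w‖ := by linarith
  have hsw : 0 < ‖stretch a b w‖ := by linarith
  refine ⟨norm_pos_iff.1 hsw, ?_, ?_⟩
  · rw [norm_inv, norm_mul, norm_mul, Complex.norm_ofNat, inv_mul_le_iff₀ (by positivity)]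
    linarith
  · rw [norm_inv, norm_mul, Complex.norm_ofNat, inv_mul_le_iff₀ (by positivity)]
    have h3 := le_norm_stretch a b z
    rw [dilatation, mul_div_assoc', le_div_iff₀ hm]
    calc (‖a‖ + ‖b‖) * ‖z‖ * (‖a‖ - ‖b‖) = (‖a‖ + ‖b‖) * ((‖a‖ - ‖b‖) * ‖z‖) := by ring
      _ ≤ (‖a‖ + ‖b‖) * (2 * ‖stretch a b w‖) := 
        mul_le_mul_of_nonneg_left (h3.trans h2) (by positivity)
      _ = _ := by ring

/-- Conjugating by `h` may cost a factor `C`, the dilatation, at every lift. The bound decays like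
`1 / |z|`, and `|f z| ≥ 8 C |z|` recovers the loss: the inductive step gives `3 C² / |z|`. -/
theorem norm_fderiv_conjSeq_sub_id_le (hR : IsLargeRadius a b p q R) (hab : ‖b‖ < ‖a‖) (k : ℕ)
    {z : ℂ} (hz : R < ‖z‖) : ‖fderiv ℝ (conjSeq a b p q k) z - ContinuousLinearMap.id ℝ ℂ‖ ≤
      4 * dilatation a b ^ 2 / ‖z‖ := by
  have hC := one_le_dilatation hab
  induction k generalizing z with
  | zero =>
    have : conjSeq a b p q 0 = id := rfl
    rw [this, fderiv_id, sub_self, norm_zero]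
    positivity
  | succ k ih =>
    have hz0 : 0 < ‖z‖ := norm_pos_iff.2 (hR.ne_zero (by linarith))
    have hw := hR.norm_conjSeq_sub_le hab (k + 1) hz.le
    obtain ⟨hne, hb1, hb2⟩ := hR.factor_bounds hab hz hw
    have hF := hR.growth z hz.le
    have hi := ih (hR.mapF_mem' hab hz)
    rw [hR.fderiv_conjSeq_succ hab k hz]
    refine (norm_conjStep_sub_id_le hab (mul_ne_zero two_ne_zero hne) _).trans ?_
    set C := dilatation a b
    have h1 : 4 * C ^ 2 / ‖mapF a b p z‖ ≤ C / (2 * ‖z‖) := by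
      calc 4 * C ^ 2 / ‖mapF a b p z‖ ≤ 4 * C ^ 2 / (8 * C * ‖z‖) := by gcongr
        _ = C / (2 * ‖z‖) := by field_simp; norm_num
    have h2 : ‖2 * stretch a b z - 2 * stretch a b (conjSeq a b p q (k + 1) z)‖ ≤
        2 * (‖a‖ + ‖b‖) := by
      rw [← mul_sub, ← stretch_sub, norm_mul, Complex.norm_ofNat]
      gcongr
      refine (norm_stretch_le a b _).trans (mul_le_of_le_one_right (by positivity) ?_)
      rwa [norm_sub_rev]
    have h3 : ‖(2 * stretch a b (conjSeq a b p q (k + 1) z))⁻¹‖ * (2 * (‖a‖ + ‖b‖)) ≤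
        2 * C / ‖z‖ := by
      rw [le_div_iff₀ hz0]
      linarith
    calc _ ≤ C * (2 * (C / (2 * ‖z‖)) + 2 * C / ‖z‖) := by
          gcongr
          · exact hi.trans h1
          · exact le_trans (by gcongr) h3
      _ = 3 * C ^ 2 / ‖z‖ := by field_simp; ring
      _ ≤ 4 * C ^ 2 / ‖z‖ := by gcongr; norm_num

theorem norm_fderiv_conjSeq_sub_id_le' (hR : IsLargeRadius a b p q R) (hab : ‖b‖ < ‖a‖) (k : ℕ)
    {z : ℂ} (hz : R < ‖z‖) : ‖fderiv ℝ (conjSeq a b p q k) z - ContinuousLinearMap.id ℝ ℂ‖ ≤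
      1 / 4 := by
  refine (hR.norm_fderiv_conjSeq_sub_id_le hab k hz).trans ?_
  have := hR.le_radius
  have hz0 : 0 < ‖z‖ := norm_pos_iff.2 (hR.ne_zero (by linarith))
  rw [div_le_div_iff₀ hz0 (by norm_num)]
  linarith

/-- Two effects contribute to the difference at `z`: the previous difference at `f z`, reduced by
the growth of `|f z|`, and the change of base point of the lift, which is at most `(1/2)^(k+1)`.
Each contributes half of the new bound. -/
theorem norm_fderiv_conjSeq_succ_sub_le (hR : IsLargeRadius a b p q R) (hab : ‖b‖ < ‖a‖) (k : ℕ)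
    {z : ℂ} (hz : R < ‖z‖) :
    ‖fderiv ℝ (conjSeq a b p q (k + 1)) z - fderiv ℝ (conjSeq a b p q k) z‖ ≤
      16 * dilatation a b ^ 2 / ‖z‖ * (1 / 2) ^ k := by
  have hC := one_le_dilatation hab
  induction k generalizing z with
  | zero =>
    have : conjSeq a b p q 0 = id := rfl
    rw [this, fderiv_id, zero_add, pow_zero, mul_one]
    refine (hR.norm_fderiv_conjSeq_sub_id_le hab 1 hz).trans ?_
    gcongr
    norm_num
  | succ k ih =>
    have hz0 : 0 < ‖z‖ := norm_pos_iff.2 (hR.ne_zero (by linarith))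
    obtain ⟨hne1, hb1, hb1'⟩ := hR.factor_bounds hab hz (hR.norm_conjSeq_sub_le hab (k + 2) hz.le)
    obtain ⟨hne2, hb2, hb2'⟩ := hR.factor_bounds hab hz (hR.norm_conjSeq_sub_le hab (k + 1) hz.le)
    have hF := hR.growth z hz.le
    have hi := ih (hR.mapF_mem' hab hz)
    have hδ := hR.norm_conjSeq_succ_sub_le hab (k + 1) hz.le
    have hB := hR.norm_fderiv_conjSeq_sub_id_le' hab k (hR.mapF_mem' hab hz)
    rw [hR.fderiv_conjSeq_succ hab (k + 1) hz, hR.fderiv_conjSeq_succ hab k hz]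
    refine (norm_conjStep_sub_conjStep_le hab _ _ _ _ _).trans ?_
    set C := dilatation a b
    set u₁ := 2 * stretch a b (conjSeq a b p q (k + 1 + 1) z)
    set u₂ := 2 * stretch a b (conjSeq a b p q (k + 1) z)
    set v := 2 * stretch a b z
    set B := fderiv ℝ (conjSeq a b p q k) (mapF a b p z)
    have hu₁ : u₁ ≠ 0 := mul_ne_zero two_ne_zero hne1
    have hu₂ : u₂ ≠ 0 := mul_ne_zero two_ne_zero hne2
    have hBn : ‖B‖ ≤ 2 := by
      have h1 := norm_sub_norm_le B (ContinuousLinearMap.id ℝ ℂ)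
      have h2 : ‖ContinuousLinearMap.id ℝ ℂ‖ ≤ 1 := ContinuousLinearMap.norm_id_le
      linarith
    have h1 : 16 * C ^ 2 / ‖mapF a b p z‖ ≤ 2 * C / ‖z‖ := by
      calc 16 * C ^ 2 / ‖mapF a b p z‖ ≤ 16 * C ^ 2 / (8 * C * ‖z‖) := by gcongr
        _ = 2 * C / ‖z‖ := by field_simp; norm_num
    have h2 : ‖u₁ - u₂‖ ≤ 2 * (‖a‖ + ‖b‖) * (1 / 2) ^ (k + 1) := by
      rw [← mul_sub, ← stretch_sub, norm_mul, Complex.norm_ofNat, mul_assoc]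
      gcongr
      exact (norm_stretch_le a b _).trans (by gcongr)
    have h3 : ‖u₁⁻¹ - u₂⁻¹‖ * ‖v‖ ≤ 4 * C / ‖z‖ * (1 / 2) ^ (k + 1) := by
      rw [inv_sub_inv hu₁ hu₂, div_eq_mul_inv, mul_inv, norm_mul, norm_mul]
      rw [norm_sub_rev]
      calc ‖u₁ - u₂‖ * (‖u₁⁻¹‖ * ‖u₂⁻¹‖) * ‖v‖ = ‖u₁⁻¹‖ * (‖u₂⁻¹‖ * ‖v‖) * ‖u₁ - u₂‖ := by ring
        _ ≤ ‖u₁⁻¹‖ * 2 * (2 * (‖a‖ + ‖b‖) * (1 / 2) ^ (k + 1)) := by gcongr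
        _ = 4 * (‖u₁⁻¹‖ * ((‖a‖ + ‖b‖) * ‖z‖)) / ‖z‖ * (1 / 2) ^ (k + 1) := by field_simp; ring
        _ ≤ _ := by gcongr
    calc _ ≤ C * (2 * (2 * C / ‖z‖ * (1 / 2) ^ k) + 4 * C / ‖z‖ * (1 / 2) ^ (k + 1) * 2) := by
          gcongr
          exact hi.trans (by gcongr)
      _ = 16 * C ^ 2 / ‖z‖ * (1 / 2) ^ (k + 1) := by rw [pow_succ]; field_simp; ring

theorem norm_fderiv_conjSeq_succ_sub_le' (hR : IsLargeRadius a b p q R) (hab : ‖b‖ < ‖a‖) (k : ℕ)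
    {z : ℂ} (hz : R < ‖z‖) :
    dist (fderiv ℝ (conjSeq a b p q k) z) (fderiv ℝ (conjSeq a b p q (k + 1)) z) ≤
      1 * (1 / 2) ^ k := by
  rw [dist_comm, dist_eq_norm]
  refine (hR.norm_fderiv_conjSeq_succ_sub_le hab k hz).trans ?_
  have := hR.le_radius
  have hz0 : 0 < ‖z‖ := norm_pos_iff.2 (hR.ne_zero (by linarith))
  gcongr
  rw [div_le_one hz0]
  linarith

theorem exists_tendsto_fderiv_conjSeq (hR : IsLargeRadius a b p q R) (hab : ‖b‖ < ‖a‖) :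
    ∃ A : ℂ → ℂ →L[ℝ] ℂ, TendstoUniformlyOn (fun k => fderiv ℝ (conjSeq a b p q k)) A atTop
      {z | R < ‖z‖} := by
  have hlim : ∀ z, R < ‖z‖ → Tendsto (fun k => fderiv ℝ (conjSeq a b p q k) z) atTop
      (𝓝 (limUnder atTop fun k => fderiv ℝ (conjSeq a b p q k) z)) := fun z hz =>
    (cauchySeq_of_le_geometric (1 / 2) 1 (by norm_num) fun k =>
      hR.norm_fderiv_conjSeq_succ_sub_le' hab k hz).tendsto_limUnder
  refine ⟨fun z => limUnder atTop fun k => fderiv ℝ (conjSeq a b p q k) z, ?_⟩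
  rw [Metric.tendstoUniformlyOn_iff]
  intro ε hε
  have h0 : Tendsto (fun k : ℕ => 1 * (1 / 2 : ℝ) ^ k / (1 - 1 / 2)) atTop (𝓝 0) := by
    have := ((tendsto_pow_atTop_nhds_zero_of_lt_one (r := (1 / 2 : ℝ)) (by norm_num)
      (by norm_num)).const_mul 1).div_const (1 - 1 / 2)
    simpa using this
  filter_upwards [h0.eventually (gt_mem_nhds hε)] with k hk z hz
  rw [dist_comm]
  exact lt_of_le_of_lt (dist_le_of_le_geometric_of_tendsto (1 / 2) 1 (by norm_num)
    (fun k => hR.norm_fderiv_conjSeq_succ_sub_le' hab k hz) (hlim z hz) k) hk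

theorem continuousOn_conjLim (hR : IsLargeRadius a b p q R) (hab : ‖b‖ < ‖a‖) :
    ContinuousOn (conjLim a b p q) {z | R < ‖z‖} :=
  (hR.tendstoUniformlyOn_conjSeq hab).continuousOn
    (Frequently.of_forall fun k => hR.continuousOn_conjSeq hab k)

theorem contDiffOn_conjLim (hR : IsLargeRadius a b p q R) (hab : ‖b‖ < ‖a‖) :
    ContDiffOn ℝ 1 (conjLim a b p q) {z | R < ‖z‖} ∧
      ∀ z, R < ‖z‖ → ‖fderiv ℝ (conjLim a b p q) z - ContinuousLinearMap.id ℝ ℂ‖ ≤ 1 / 4 := by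
  obtain ⟨A, hA⟩ := hR.exists_tendsto_fderiv_conjSeq hab
  have hd : ∀ z, R < ‖z‖ → HasFDerivAt (conjLim a b p q) (A z) z := fun z hz =>
    hasFDerivAt_of_tendstoUniformlyOn (isOpen_norm_gt R) hA
      (fun k x hx => (((hR.contDiffOn_conjSeq hab k).contDiffAt
        ((isOpen_norm_gt R).mem_nhds hx)).differentiableAt one_ne_zero).hasFDerivAt)
      (fun x hx => hR.tendsto_conjSeq hab (le_of_lt hx)) hz
  have hc : ContinuousOn A {z | R < ‖z‖} := hA.continuousOn (Frequently.of_forall fun k =>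
    (hR.contDiffOn_conjSeq hab k).continuousOn_fderiv_of_isOpen (isOpen_norm_gt R) le_rfl)
  refine ⟨?_, fun z hz => ?_⟩
  · rw [show (1 : WithTop ℕ∞) = 0 + 1 from rfl,
      contDiffOn_succ_iff_fderiv_of_isOpen (isOpen_norm_gt R)]
    refine ⟨fun z hz => (hd z hz).differentiableAt.differentiableWithinAt, by simp, ?_⟩
    rw [contDiffOn_zero]
    exact hc.congr fun z hz => (hd z hz).fderiv
  · rw [(hd z hz).fderiv]
    exact le_of_tendsto ((hA.tendsto_at hz).sub_const _).norm
      (Eventually.of_forall fun k => hR.norm_fderiv_conjSeq_sub_id_le' hab k hz)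

end IsLargeRadius

/-! ### Conjugate pairs -/

/-- Each iterate doubles the distance of the orbits while it stays at most 2. Only expansion of `H`
enters, so the additive constant `c` is arbitrary. -/
theorem IsLargeRadius.eq_of_shadowing {a b p q : ℂ} {R : ℝ} (hR : IsLargeRadius a b p q R)
    (c : ℂ) {x y : ℂ} (hx : ∀ n, R - 1 ≤ ‖(mapF a b c)^[n] x‖)
    (h : ∀ n, ‖(mapF a b c)^[n] x - (mapF a b c)^[n] y‖ ≤ 2) : x = y := by
  have hgrow : ∀ n, 2 ^ n * ‖x - y‖ ≤ ‖(mapF a b c)^[n] x - (mapF a b c)^[n] y‖ := by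
    intro n
    induction n with
    | zero => simp
    | succ n ih =>
      have := hR.expand _ _ (hx n) (h n)
      rw [Function.iterate_succ_apply', Function.iterate_succ_apply', mapF, mapF,
        add_sub_add_right_eq_sub, pow_succ]
      linarith
  by_contra hne
  have hpos : 0 < ‖x - y‖ := norm_pos_iff.2 (sub_ne_zero.2 hne)
  obtain ⟨n, hn⟩ := pow_unbounded_of_one_lt (2 / ‖x - y‖) (one_lt_two (α := ℝ))
  rw [div_lt_iff₀ hpos] at hn
  linarith [hgrow n, h n]

/-- The maps are even, so the values at `z` and `-z` agree up to sign. Equal values would lie within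
1 of both `z` and `-z`, which are at distance at least 8. -/
theorem IsLargeRadius.conjLim_neg {a b p q : ℂ} {R : ℝ} (hR : IsLargeRadius a b p q R)
    (hab : ‖b‖ < ‖a‖) {z : ℂ} (hz : R ≤ ‖z‖) : conjLim a b p q (-z) = -conjLim a b p q z := by
  have hz' : R ≤ ‖-z‖ := by rwa [norm_neg]
  have h1 := hR.mapF_conjLim hab hz
  have h2 := hR.mapF_conjLim hab hz'
  rw [mapF_neg, ← h1] at h2
  rcases (mapF_eq_mapF_iff hab).1 h2 with h | h
  · exfalso
    have h3 := hR.norm_conjLim_sub_le hab hz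
    have h4 := hR.norm_conjLim_sub_le hab hz'
    rw [h] at h4
    have h5 := norm_sub_le (conjLim a b p q z - -z) (conjLim a b p q z - z)
    have h6 : conjLim a b p q z - -z - (conjLim a b p q z - z) = 2 * z := by ring
    rw [h6, norm_mul, Complex.norm_ofNat] at h5
    linarith [hR.four_le]
  · exact h

/-- The set `X` need not be simply connected, so a root must be given near infinity. It is carried
inwards along rays: `T z` is the least dilation factor, at least 1, that takes `z` to norm at least
`r`, and the homotopy runs from `T z * z` to `z`. It is stationary where `r ≤ ‖z‖`, so the root
there is `s₀`. -/
theorem exists_continuousOn_sqrt_of_isRadial {X : Set ℂ} (hX : IsRadial X) (h0 : (0 : ℂ) ∉ X)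
    {g s₀ : ℂ → ℂ} {r : ℝ} (hg : ContinuousOn g X) (hne : ∀ z ∈ X, g z ≠ 0)
    (hs₀ : ContinuousOn s₀ {z | r ≤ ‖z‖}) (hsq : ∀ z ∈ X, r ≤ ‖z‖ → s₀ z ^ 2 = g z) :
    ∃ s : ℂ → ℂ, ContinuousOn s X ∧ (∀ z ∈ X, s z ^ 2 = g z) ∧
      ∀ z ∈ X, r ≤ ‖z‖ → s z = s₀ z := by
  classical
  have hz0 : ∀ z : X, 0 < ‖(z : ℂ)‖ := fun z => norm_pos_iff.2 fun h => h0 (h ▸ z.2)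
  let T : X → ℝ := fun z => max 1 (r / ‖(z : ℂ)‖)
  have hT : Continuous T := by
    refine continuous_const.max (continuous_const.div (by fun_prop) fun z => (hz0 z).ne')
  have hT1 : ∀ z, 1 ≤ T z := fun z => le_max_left _ _
  have hTr : ∀ z : X, r ≤ ‖(T z : ℂ) * (z : ℂ)‖ := by
    intro z
    rw [norm_mul, Complex.norm_real, Real.norm_of_nonneg (zero_le_one.trans (hT1 z)),
      ← div_le_iff₀ (hz0 z)]
    exact le_max_right _ _
  let τ : unitInterval × X → ℝ := fun p => (1 - (p.1 : ℝ)) * T p.2 + p.1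
  have hτ : Continuous τ := by fun_prop
  have hτ1 : ∀ p, 1 ≤ τ p := by
    intro p
    have h1 := p.1.2.1
    have h2 := p.1.2.2
    have := mul_le_mul_of_nonneg_left (hT1 p.2) (sub_nonneg.2 h2)
    simp only [τ]
    linarith
  have hmem : ∀ p, (τ p : ℂ) * (p.2 : ℂ) ∈ X := fun p => hX _ p.2.2 _ (hτ1 p)
  have hmem' : ∀ z : X, (T z : ℂ) * (z : ℂ) ∈ X := fun z => hX _ z.2 _ (hT1 z)
  obtain ⟨s, hs, hss, hs1⟩ := exists_continuous_sqrt_of_homotopy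
    (fun p => g ((τ p : ℂ) * (p.2 : ℂ)))
    (hg.comp_continuous (by fun_prop) hmem) (fun p => hne _ (hmem p))
    (fun z => s₀ ((T z : ℂ) * (z : ℂ))) (hs₀.comp_continuous (by fun_prop) hTr)
    (fun z => by simpa [τ] using hsq _ (hmem' z) (hTr z))
  refine ⟨fun z => if h : z ∈ X then s ⟨z, h⟩ else 0, ?_, fun z hz => ?_, fun z hz hzr => ?_⟩
  · rw [continuousOn_iff_continuous_domRestrict]
    refine hs.congr fun z => ?_
    simp [z.2]
  · simpa [hz, τ] using hss ⟨z, hz⟩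
  · have h1 : T ⟨z, hz⟩ = 1 := max_eq_left ((div_le_one (hz0 ⟨z, hz⟩)).2 hzr)
    have := hs1 ⟨z, hz⟩ fun t => by simp [τ, h1]
    simpa [hz, h1] using this

/-- The domains in the plane of `mapH` on which inverse Böttcher maps are constructed. -/
structure IsAdmissible (a b : ℂ) (R : ℝ) (V : Set ℂ) : Prop where
  radial : IsRadial V
  zero_notMem : (0 : ℂ) ∉ V
  large : {z : ℂ | R + 1 < ‖z‖} ⊆ V
  mapsTo : Set.MapsTo (mapH a b) V V

theorem IsAdmissible.preimage {a b : ℂ} {R : ℝ} {V : Set ℂ} (hV : IsAdmissible a b R V) :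
    IsAdmissible a b R (mapH a b ⁻¹' V) where
  radial z hz t ht := by
    rw [Set.mem_preimage, mapH_real_mul]
    exact hV.radial _ hz _ (one_le_pow₀ ht)
  zero_notMem h := hV.zero_notMem (by simpa [mapH_zero] using h)
  large _ hz := hV.mapsTo (hV.large hz)
  mapsTo _ hz := hV.mapsTo hz

theorem IsAdmissible.isPreconnected {a b : ℂ} {R : ℝ} {V : Set ℂ} (hV : IsAdmissible a b R V)
    (hR : 4 ≤ R) : IsPreconnected V :=
  hV.radial.isPreconnected hV.zero_notMem (by linarith) hV.large

/-- `φ : V → U` and `Ψ : U → V` are mutually inverse conjugacies between `mapH` and `mapF` which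
extend the ones near infinity. -/
structure IsConjPair (a b c : ℂ) (R : ℝ) (V U : Set ℂ) (φ Ψ : ℂ → ℂ) : Prop where
  isOpen : IsOpen U
  largeU : ∀ z, R + 4 ≤ ‖z‖ → z ∈ U
  continuousOn : ContinuousOn φ V
  mapsTo : Set.MapsTo φ V U
  mapsTo_inv : Set.MapsTo Ψ U V
  left_inv : Set.LeftInvOn Ψ φ V
  right_inv : Set.LeftInvOn φ Ψ U
  contDiffOn : ContDiffOn ℝ 1 Ψ U
  distortion : ∃ K : ℝ, 1 ≤ K ∧ ∀ z ∈ U, ‖fderiv ℝ Ψ z‖ ^ 2 ≤ K * (fderiv ℝ Ψ z).det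
  semiconj : ∀ z ∈ V, mapF a b c (φ z) = φ (mapH a b z)
  near : ∀ z, R + 3 ≤ ‖z‖ → φ z = conjLim a b 0 c z
  near_inv : ∀ z, R + 4 ≤ ‖z‖ → Ψ z = conjLim a b c 0 z

theorem norm_ofReal_add_three {R : ℝ} (hR : 4 ≤ R) : ‖((R + 3 : ℝ) : ℂ)‖ = R + 3 := by
  rw [Complex.norm_real, Real.norm_of_nonneg (by linarith)]

section

variable {a b c : ℂ} {R : ℝ} {V U : Set ℂ} {φ Ψ : ℂ → ℂ}

/-- Along the relevant orbits `Ψ ∘ φ` commutes with `H` and `φ ∘ Ψ` with `f`, and each moves points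
by at most 2. The orbits of a point and of its image therefore shadow each other, so the two points
coincide. -/
theorem isConjPair_base (hab : ‖b‖ < ‖a‖) (hR : IsLargeRadius a b c 0 R)
    (hR' : IsLargeRadius a b 0 c R) :
    IsConjPair a b c R {z | R + 1 < ‖z‖} {z | R < ‖z‖ ∧ R + 1 < ‖conjLim a b c 0 z‖}
      (conjLim a b 0 c) (conjLim a b c 0) := by
  set φ := conjLim a b 0 c
  set Ψ := conjLim a b c 0
  set V := {z : ℂ | R + 1 < ‖z‖}
  set U := {z : ℂ | R < ‖z‖ ∧ R + 1 < ‖Ψ z‖}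
  have hφn : ∀ {z}, R ≤ ‖z‖ → ‖φ z - z‖ ≤ 1 := fun hz => hR'.norm_conjLim_sub_le hab hz
  have hΨn : ∀ {z}, R ≤ ‖z‖ → ‖Ψ z - z‖ ≤ 1 := fun hz => hR.norm_conjLim_sub_le hab hz
  have hfφ : ∀ {z}, R ≤ ‖z‖ → mapF a b c (φ z) = φ (mapH a b z) := fun hz => by
    rw [← mapF_zero_right]; exact hR'.mapF_conjLim hab hz
  have hHΨ : ∀ {z}, R ≤ ‖z‖ → mapH a b (Ψ z) = Ψ (mapF a b c z) := fun hz => by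
    rw [← mapF_zero_right]; exact hR.mapF_conjLim hab hz
  have hVH : Set.MapsTo (mapH a b) V V := fun z hz => by
    have := hR'.le_norm_mapF hab (z := z) (by linarith [Set.mem_ofPred.1 hz])
    rw [mapF_zero_right] at this
    have h1 : R + 1 < ‖z‖ := hz
    show R + 1 < _
    linarith [hR.four_le]
  have hUF : Set.MapsTo (mapF a b c) U U := fun z hz => by
    refine ⟨hR.mapF_mem' hab hz.1, ?_⟩
    rw [← hHΨ hz.1.le]
    exact hVH hz.2
  have hφR : ∀ {z}, z ∈ V → R < ‖φ z‖ := fun {z} hz => by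
    have h1 := norm_sub_norm_le z (φ z)
    have h2 : R + 1 < ‖z‖ := hz
    rw [norm_sub_rev] at h1
    linarith [hφn (z := z) (by linarith)]
  have hleft : Set.LeftInvOn Ψ φ V := fun z hz => by
    have hit : ∀ n, (mapH a b)^[n] z ∈ V := fun n => hVH.iterate n hz
    have hcomm : ∀ n, (mapH a b)^[n] (Ψ (φ z)) = Ψ (φ ((mapH a b)^[n] z)) := by
      intro n
      induction n with
      | zero => rfl
      | succ n ih =>
        have h1 : R + 1 < ‖(mapH a b)^[n] z‖ := hit n
        rw [Function.iterate_succ_apply', Function.iterate_succ_apply', ih,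
          hHΨ (hφR (hit n)).le, hfφ (by linarith)]
    symm
    refine hR.eq_of_shadowing 0 (fun n => ?_) (fun n => ?_)
    · simp only [funext (mapF_zero_right a b)]
      have h1 : R + 1 < ‖(mapH a b)^[n] z‖ := hit n
      linarith
    · simp only [funext (mapF_zero_right a b), hcomm]
      have h1 : R + 1 < ‖(mapH a b)^[n] z‖ := hit n
      have h2 := hφn (z := (mapH a b)^[n] z) (by linarith)
      have h3 := hΨn (hφR (hit n)).le
      rw [norm_sub_rev]
      have := norm_add_le (Ψ (φ ((mapH a b)^[n] z)) - φ ((mapH a b)^[n] z))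
        (φ ((mapH a b)^[n] z) - (mapH a b)^[n] z)
      rw [sub_add_sub_cancel] at this
      linarith
  have hright : Set.LeftInvOn φ Ψ U := fun z hz => by
    have hit : ∀ n, (mapF a b c)^[n] z ∈ U := fun n => hUF.iterate n hz
    have hcomm : ∀ n, (mapF a b c)^[n] (φ (Ψ z)) = φ (Ψ ((mapF a b c)^[n] z)) := by
      intro n
      induction n with
      | zero => rfl
      | succ n ih =>
        rw [Function.iterate_succ_apply', Function.iterate_succ_apply', ih,
          hfφ (by linarith [(hit n).2]), hHΨ (hit n).1.le]
    symm
    refine hR.eq_of_shadowing c (fun n => ?_) (fun n => ?_)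
    · linarith [(hit n).1]
    · rw [hcomm]
      have h2 := hΨn (z := (mapF a b c)^[n] z) (hit n).1.le
      have h3 := hφn (z := Ψ ((mapF a b c)^[n] z)) (by linarith [(hit n).2])
      rw [norm_sub_rev]
      have := norm_add_le (φ (Ψ ((mapF a b c)^[n] z)) - Ψ ((mapF a b c)^[n] z))
        (Ψ ((mapF a b c)^[n] z) - (mapF a b c)^[n] z)
      rw [sub_add_sub_cancel] at this
      linarith
  obtain ⟨hC, hD⟩ := hR.contDiffOn_conjLim hab
  refine ⟨?_, fun z hz => ⟨by linarith, ?_⟩, ?_, fun z hz => ⟨hφR hz, ?_⟩, fun z hz => hz.2,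
    hleft, hright, hC.mono fun z hz => hz.1,
    ⟨4, by norm_num, fun z hz => distortion_of_near_id (hD z hz.1)⟩,
    fun z hz => hfφ (by linarith [Set.mem_ofPred.1 hz]), fun z _ => rfl, fun z _ => rfl⟩
  · exact (hR.continuousOn_conjLim hab).norm.isOpen_inter_preimage
      (IsLargeRadius.isOpen_norm_gt R) isOpen_Ioi
  · have h1 := norm_sub_norm_le z (Ψ z)
    rw [norm_sub_rev] at h1
    linarith [hΨn (z := z) (by linarith)]
  · exact (hR'.continuousOn_conjLim hab).mono fun z hz => by
      show R < _
      linarith [Set.mem_ofPred.1 hz]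
  · rw [hleft hz]; exact hz

theorem IsConjPair.conj_inv (hP : IsConjPair a b c R V U φ Ψ) (hVH : Set.MapsTo (mapH a b) V V)
    {z : ℂ} (hz : z ∈ U) : mapF a b c z ∈ U ∧ mapH a b (Ψ z) = Ψ (mapF a b c z) := by
  have hV := hP.mapsTo_inv hz
  have h1 := hP.semiconj _ hV
  rw [hP.right_inv hz] at h1
  rw [h1]
  exact ⟨hP.mapsTo (hVH hV), (hP.left_inv (hVH hV)).symm⟩

/-- A square root of `φ ∘ mapH - c` on a radial set, normalised at infinity. -/
theorem IsConjPair.exists_lift (hab : ‖b‖ < ‖a‖) (hR' : IsLargeRadius a b 0 c R)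
    (hP : IsConjPair a b c R V U φ Ψ) {X : Set ℂ} (hX : IsRadial X) (h0 : (0 : ℂ) ∉ X)
    (hXV : Set.MapsTo (mapH a b) X V) (hne : ∀ z ∈ X, φ (mapH a b z) ≠ c) :
    ∃ χ : ℂ → ℂ, ContinuousOn χ X ∧ (∀ z ∈ X, mapF a b c (χ z) = φ (mapH a b z)) ∧
      ∀ z ∈ X, R + 3 ≤ ‖z‖ → χ z = conjLim a b 0 c z := by
  have h4 := hR'.four_le
  obtain ⟨s, hs, hsq, hs1⟩ := exists_continuousOn_sqrt_of_isRadial hX h0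
    (g := fun z => φ (mapH a b z) - c) (s₀ := fun z => stretch a b (conjLim a b 0 c z))
    (r := R + 3)
    ((hP.continuousOn.comp (continuous_mapH a b).continuousOn hXV).sub continuousOn_const)
    (fun z hz => sub_ne_zero.2 (hne z hz))
    ((continuous_stretch a b).comp_continuousOn ((hR'.continuousOn_conjLim hab).mono fun z hz => by
      show R < _
      linarith [Set.mem_ofPred.1 hz]))
    (fun z _ hzr => by
      have h1 := hR'.mapF_conjLim hab (z := z) (by linarith)
      have h2 := hR'.le_norm_mapF hab (z := z) (by linarith)
      rw [mapF_zero_right] at h1 h2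
      rw [hP.near _ (by linarith), ← h1, mapF, mapH, add_sub_cancel_right])
  refine ⟨fun z => stretchInv a b (s z), (continuous_stretchInv hab).comp_continuousOn hs,
    fun z hz => ?_, fun z hz hzr => ?_⟩
  · rw [mapF, mapH, stretch_stretchInv hab, hsq z hz, sub_add_cancel]
  · simp only [hs1 z hz hzr, stretchInv_stretch hab]

/-- Two lifts through `mapF` on a connected set which avoid the critical point agree everywhere
if they agree at one point. -/
theorem eqOn_of_mapF_eq (hab : ‖b‖ < ‖a‖) {S : Set ℂ} (hS : IsPreconnected S) {χ₁ χ₂ : ℂ → ℂ}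
    (h1 : ContinuousOn χ₁ S) (h2 : ContinuousOn χ₂ S)
    (h : ∀ z ∈ S, mapF a b c (χ₁ z) = mapF a b c (χ₂ z)) (hne : ∀ z ∈ S, χ₂ z ≠ 0) {x : ℂ}
    (hx : x ∈ S) (hxe : χ₁ x = χ₂ x) : Set.EqOn χ₁ χ₂ S := by
  have hc := continuous_stretch a b
  have := hS.eq_of_sq_eq (hc.comp_continuousOn h1) (hc.comp_continuousOn h2)
    (fun z hz => by simpa [mapF, mapH] using h z hz)
    (fun {z} hz => stretch_ne_zero hab (hne z hz)) hx (by simp [hxe])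
  exact fun z hz => stretch_injective hab (this hz)

/-- The new `φ'` is a lift of `φ ∘ H` through `f`, which exists because `φ` never takes the critical
value `c`. It is odd, and the fibres of `H` and `f` are pairs `±z`, so bijectivity passes from `φ`
to `φ'`. -/
theorem IsConjPair.exists_preimage (hab : ‖b‖ < ‖a‖) (hR : IsLargeRadius a b c 0 R)
    (hR' : IsLargeRadius a b 0 c R)
    (hV : IsAdmissible a b R V) (hP : IsConjPair a b c R V U φ Ψ) (hc : c ∉ U) :
    ∃ φ' Ψ' : ℂ → ℂ, IsConjPair a b c R (mapH a b ⁻¹' V) (mapF a b c ⁻¹' U) φ' Ψ' := by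
  have h4 := hR.four_le
  have hV' := hV.preimage
  set V' := mapH a b ⁻¹' V with hV'_def
  set U' := mapF a b c ⁻¹' U with hU'_def
  have hsub : V ⊆ V' := fun z hz => hV.mapsTo hz
  obtain ⟨φ', hcont, hlift, hnear⟩ := hP.exists_lift hab hR' hV'.radial hV'.zero_notMem
    (fun z hz => hz) (fun z hz h => hc (h ▸ hP.mapsTo hz))
  have hbig : ∀ z : ℂ, R + 3 ≤ ‖z‖ → z ∈ V := fun z hz => hV.large (by
    show R + 1 < ‖z‖
    linarith)
  have hmaps : Set.MapsTo φ' V' U' := fun z hz => by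
    show mapF a b c (φ' z) ∈ U
    rw [hlift z hz]
    exact hP.mapsTo hz
  have h0U : (0 : ℂ) ∉ U' := fun h => hc (by simpa [hU'_def, mapF_zero] using h)
  have hne : ∀ z ∈ V', φ' z ≠ 0 := fun z hz h => h0U (h ▸ hmaps hz)
  have hx3 := norm_ofReal_add_three h4
  have hxV : ((R + 3 : ℝ) : ℂ) ∈ V := hbig _ hx3.ge
  have hnegV : ∀ z ∈ V', -z ∈ V' := fun z hz => by
    rwa [hV'_def, Set.mem_preimage, mapH_neg]
  have hodd : ∀ z ∈ V', φ' (-z) = -φ' z := by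
    refine eqOn_of_mapF_eq (c := c) hab (hV'.isPreconnected h4)
      (hcont.comp continuous_neg.continuousOn hnegV) hcont.neg (fun z hz => ?_)
      (fun z hz => neg_ne_zero.2 (hne z hz)) (hsub hxV) ?_
    · rw [mapF_neg, hlift z hz, hlift _ (hnegV z hz), mapH_neg]
    · rw [hnear _ (hsub hxV) hx3.ge,
        hnear _ (hnegV _ (hsub hxV)) (by rw [norm_neg, hx3]),
        hR'.conjLim_neg hab (by linarith)]
  have hinj : Set.InjOn φ' V' := by
    intro z hz w hw h
    have h1 : φ (mapH a b z) = φ (mapH a b w) := by rw [← hlift z hz, ← hlift w hw, h]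
    have h2 : mapH a b z = mapH a b w := hP.left_inv.injOn hz hw h1
    rcases (mapH_eq_mapH_iff hab).1 h2 with h3 | h3
    · exact h3
    · rw [h3, hodd w hw] at h
      exact absurd (self_eq_neg.1 h.symm) (hne w hw)
  have hsurj : Set.SurjOn φ' V' U' := by
    intro z hz
    obtain ⟨v, hv⟩ := mapH_surjective hab (Ψ (mapF a b c z))
    have hvV : v ∈ V' := by
      rw [hV'_def, Set.mem_preimage, hv]
      exact hP.mapsTo_inv hz
    have h1 : mapF a b c (φ' v) = mapF a b c z := by
      rw [hlift v hvV, hv, hP.right_inv hz]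
    rcases (mapF_eq_mapF_iff hab).1 h1 with h | h
    · exact ⟨v, hvV, h⟩
    · exact ⟨-v, hnegV v hvV, by rw [hodd v hvV, h, neg_neg]⟩
  set Ψ' := Function.invFunOn φ' V'
  have hleft : Set.LeftInvOn Ψ' φ' V' := hinj.leftInvOn_invFunOn
  have hright : Set.LeftInvOn φ' Ψ' U' := hsurj.rightInvOn_invFunOn
  have hmapsΨ : Set.MapsTo Ψ' U' V' := hsurj.mapsTo_invFunOn
  have hU' : IsOpen U' := hP.isOpen.preimage (continuous_mapF a b c)
  have hconj : ∀ z ∈ U', mapH a b (Ψ' z) = Ψ (mapF a b c z) := by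
    intro z hz
    have h1 := hlift _ (hmapsΨ hz)
    rw [hright hz] at h1
    rw [h1, hP.left_inv (hmapsΨ hz)]
  have hΨ0 : ∀ z ∈ U', Ψ' z ≠ 0 := fun z hz h => hV'.zero_notMem (h ▸ hmapsΨ hz)
  have hΨd : ∀ z ∈ U', ContDiffAt ℝ 1 Ψ (mapF a b c z) := fun z hz =>
    hP.contDiffOn.contDiffAt (hP.isOpen.mem_nhds hz)
  -- Near `z₀`, lift `Ψ ∘ f` through a local inverse `ℓ` of `H` with value `Ψ' z₀` at `z₀`. Applying
  -- `φ'` to this continuous lift gives `z` or `-z`; being close to `z₀ ≠ 0` it must be `z`, so the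
  -- lift equals `Ψ'`.
  have hΨcont : ∀ z ∈ U', ContinuousAt Ψ' z := by
    intro z₀ hz₀
    obtain ⟨ℓ, hℓ, -, hl, hr⟩ := exists_local_inverse_mapH hab (hΨ0 z₀ hz₀)
    have hl0 : ℓ (Ψ (mapF a b c z₀)) = Ψ' z₀ := by
      rw [← hconj z₀ hz₀]; exact hl.self_of_nhds
    have hg : ContinuousAt (fun z => Ψ (mapF a b c z)) z₀ :=
      (hΨd z₀ hz₀).continuousAt.comp (continuous_mapF a b c).continuousAt
    rw [hconj z₀ hz₀] at hr hℓ
    have hσ : ContinuousAt (fun z => ℓ (Ψ (mapF a b c z))) z₀ :=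
      ContinuousAt.comp (g := ℓ) hℓ.continuousAt hg
    have hHσ : ∀ᶠ z in 𝓝 z₀, mapH a b (ℓ (Ψ (mapF a b c z))) = Ψ (mapF a b c z) :=
      hg.eventually hr
    have hσV : ∀ᶠ z in 𝓝 z₀, ℓ (Ψ (mapF a b c z)) ∈ V' := by
      filter_upwards [hHσ, hU'.mem_nhds hz₀] with z h1 h2
      rw [hV'_def, Set.mem_preimage, h1]
      exact hP.mapsTo_inv h2
    have hφσ : Tendsto (fun z => φ' (ℓ (Ψ (mapF a b c z)))) (𝓝 z₀) (𝓝 z₀) := by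
      have h1 := hcont (Ψ' z₀) (hmapsΨ hz₀)
      rw [ContinuousWithinAt, hright hz₀] at h1
      refine h1.comp (tendsto_nhdsWithin_iff.2 ⟨?_, hσV⟩)
      have h2 := hσ.tendsto
      rwa [hl0] at h2
    have hz₀0 : z₀ ≠ 0 := fun h => h0U (h ▸ hz₀)
    have hsum : ∀ᶠ z in 𝓝 z₀, φ' (ℓ (Ψ (mapF a b c z))) + z ≠ 0 := by
      refine (hφσ.add tendsto_id).eventually_ne ?_
      rw [← two_mul]
      exact mul_ne_zero two_ne_zero hz₀0
    refine hσ.congr ?_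
    filter_upwards [hHσ, hσV, hsum, hU'.mem_nhds hz₀] with z h1 h2 h3 h5
    have h6 : mapF a b c (φ' (ℓ (Ψ (mapF a b c z)))) = mapF a b c z := by
      rw [hlift _ h2, h1, hP.right_inv h5]
    rcases (mapF_eq_mapF_iff hab).1 h6 with h | h
    · rw [← hleft h2, h]
    · exact absurd (by rw [h, neg_add_cancel]) h3
  have hev : ∀ z ∈ U', ∀ᶠ y in 𝓝 z, mapH a b (Ψ' y) = Ψ (mapF a b c y) := fun z hz => by
    filter_upwards [hU'.mem_nhds hz] with y hy using hconj y hy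
  -- Both maps lift `φ ∘ H` on the connected set `V` and agree near infinity. A zero of `φ` would
  -- put 0, and hence `c = f 0`, into `U`.
  have hext : Set.EqOn φ' φ V := by
    refine eqOn_of_mapF_eq (c := c) hab (hV.isPreconnected h4) (hcont.mono hsub) hP.continuousOn
      (fun z hz => by rw [hlift z (hsub hz), hP.semiconj z hz])
      (fun z hz h => ?_) hxV (by rw [hnear _ (hsub hxV) hx3.ge, hP.near _ hx3.ge])
    have h1 := hP.mapsTo hz
    rw [h] at h1
    exact hc (by simpa [mapF_zero] using (hP.conj_inv hV.mapsTo h1).1)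
  refine ⟨φ', Ψ', hU', fun z hz => (hP.conj_inv hV.mapsTo (hP.largeU z hz)).1, hcont, hmaps,
    hmapsΨ, hleft, hright, fun z hz => ?_, ?_, fun z hz => by rw [hlift z hz, hext hz],
    fun z hz => hnear z (hsub (hbig z hz)) hz, fun z hz => ?_⟩
  · exact (contDiffAt_of_mapH_comp hab (hΨcont z hz) (hΨ0 z hz)
      ((hΨd z hz).comp z (contDiff_mapF a b c).contDiffAt) (hev z hz)).contDiffWithinAt
  · obtain ⟨K, hK, hd⟩ := hP.distortion
    refine ⟨dilatation a b ^ 2 * K, ?_, fun z hz => ?_⟩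
    · exact one_le_mul_of_one_le_of_one_le (one_le_pow₀ (one_le_dilatation hab)) hK
    · rw [(hasFDerivAt_of_mapH_comp hab (hΨcont z hz) (hΨ0 z hz)
        ((hΨd z hz).differentiableAt one_ne_zero).hasFDerivAt (hev z hz)).fderiv]
      exact conjStep_distortion hab _ _ (hd _ hz)
  · have hzU := hP.largeU z hz
    have h1 := hP.near_inv z hz
    have h2 : R + 3 ≤ ‖Ψ z‖ := by
      have h3 := norm_sub_norm_le z (Ψ z)
      rw [norm_sub_rev, h1] at h3
      rw [h1]
      linarith [hR.norm_conjLim_sub_le hab (z := z) (by linarith)]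
    have h3 : φ' (Ψ z) = z := by
      rw [hext (hP.mapsTo_inv hzU), hP.right_inv hzU]
    rw [← h1, ← hleft (hsub (hP.mapsTo_inv hzU)), h3]

end

/-! ### Escaping sets -/

theorem mem_escapingSet_iff {g : ℂ → ℂ} {z : ℂ} :
    z ∈ escapingSet g ↔ Tendsto (fun n : ℕ => ‖g^[n] z‖) atTop atTop := by
  rw [tendsto_norm_atTop_iff_cobounded, Metric.cobounded_eq_cocompact]
  rfl

theorem apply_mem_escapingSet_iff {g : ℂ → ℂ} {z : ℂ} :
    g z ∈ escapingSet g ↔ z ∈ escapingSet g :=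
  tendsto_add_atTop_iff_nat (f := fun n => g^[n] z) 1

theorem IsLargeRadius.mem_escapingSet {a b p q : ℂ} {R : ℝ} (hR : IsLargeRadius a b p q R)
    (hab : ‖b‖ < ‖a‖) {z : ℂ} (hz : R ≤ ‖z‖) : z ∈ escapingSet (mapF a b p) := by
  have h : ∀ n, R ≤ ‖(mapF a b p)^[n] z‖ ∧ 2 ^ n * R ≤ ‖(mapF a b p)^[n] z‖ := by
    intro n
    induction n with
    | zero => simpa using hz
    | succ n ih =>
      rw [Function.iterate_succ_apply', pow_succ]
      have := hR.le_norm_mapF hab ih.1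
      exact ⟨hR.mapF_mem hab ih.1, by linarith [ih.2]⟩
  rw [mem_escapingSet_iff]
  exact tendsto_atTop_mono (fun n => (h n).2)
    ((tendsto_pow_atTop_atTop_of_one_lt one_lt_two).atTop_mul_const
      (by linarith [hR.four_le]))

/-- Iterated preimages of a set. -/
def preimages (g : ℂ → ℂ) (S : Set ℂ) : ℕ → Set ℂ
  | 0 => S
  | n + 1 => g ⁻¹' preimages g S n

theorem mem_preimages {g : ℂ → ℂ} {S : Set ℂ} {n : ℕ} {z : ℂ} :
    z ∈ preimages g S n ↔ g^[n] z ∈ S := by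
  induction n generalizing z with
  | zero => rfl
  | succ n ih => exact ih

theorem preimages_subset {g : ℂ → ℂ} {S T : Set ℂ} (hS : S ⊆ T) (hT : g ⁻¹' T ⊆ T) (n : ℕ) :
    preimages g S n ⊆ T := by
  induction n with
  | zero => exact hS
  | succ n ih => exact fun z hz => hT (ih hz)

theorem preimages_mono {g : ℂ → ℂ} {S : Set ℂ} (hS : Set.MapsTo g S S) :
    Monotone (preimages g S) := by
  refine monotone_nat_of_le_succ fun n => ?_
  induction n with
  | zero => exact hS
  | succ n ih => exact fun z hz => ih hz

section

variable {a b c : ℂ} {R : ℝ} {V U : Set ℂ} {φ Ψ : ℂ → ℂ}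

theorem IsLargeRadius.isAdmissible (hab : ‖b‖ < ‖a‖) (hR' : IsLargeRadius a b 0 c R) :
    IsAdmissible a b R {z | R + 1 < ‖z‖} where
  radial z hz t ht := by
    have h1 : R + 1 < ‖z‖ := hz
    show R + 1 < ‖(t : ℂ) * z‖
    rw [norm_mul, Complex.norm_real, Real.norm_of_nonneg (by linarith)]
    nlinarith [norm_nonneg z]
  zero_notMem h := by
    have h1 : R + 1 < ‖(0 : ℂ)‖ := h
    rw [norm_zero] at h1
    linarith [hR'.four_le]
  large := subset_rfl
  mapsTo z hz := by
    have h1 : R + 1 < ‖z‖ := hz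
    have := hR'.le_norm_mapF hab (z := z) (by linarith)
    rw [mapF_zero_right] at this
    show R + 1 < ‖mapH a b z‖
    linarith [hR'.four_le]

theorem IsAdmissible.preimages (hV : IsAdmissible a b R V) (n : ℕ) :
    IsAdmissible a b R (preimages (mapH a b) V n) := by
  induction n with
  | zero => exact hV
  | succ n ih => exact ih.preimage

/-- A pullback only requires `c` to miss the set being pulled back, so the last set, at index `n`,
may contain `c`. -/
theorem exists_isConjPair (hab : ‖b‖ < ‖a‖) (hR : IsLargeRadius a b c 0 R)
    (hR' : IsLargeRadius a b 0 c R) (hV : IsAdmissible a b R V)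
    (hP : IsConjPair a b c R V U φ Ψ) (n : ℕ) (hc : ∀ k < n, c ∉ preimages (mapF a b c) U k) :
    ∃ φ' Ψ' : ℂ → ℂ, IsConjPair a b c R (preimages (mapH a b) V n)
      (preimages (mapF a b c) U n) φ' Ψ' := by
  induction n with
  | zero => exact ⟨φ, Ψ, hP⟩
  | succ n ih =>
    obtain ⟨φ', Ψ', h⟩ := ih fun k hk => hc k (hk.trans n.lt_succ_self)
    exact h.exists_preimage hab hR hR' (hV.preimages n) (hc n n.lt_succ_self)

/-! ### Uniqueness -/

/-- A continuous map commuting with `mapH` which is the identity near infinity is the identity. -/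
theorem IsAdmissible.eqOn_id (hab : ‖b‖ < ‖a‖) (hR' : IsLargeRadius a b 0 c R)
    (hV : IsAdmissible a b R V) (hVI : V ⊆ escapingSet (mapH a b)) {θ : ℂ → ℂ}
    (hθ : ContinuousOn θ V) (hcomm : ∀ z ∈ V, mapH a b (θ z) = θ (mapH a b z)) {r : ℝ}
    (hr : ∀ z, r < ‖z‖ → θ z = z) : Set.EqOn θ id V := by
  have h4 := hR'.four_le
  set r' := max r (R + 1) with hr'
  have hr1 : R + 1 ≤ r' := le_max_right _ _
  have hrpos : 0 < r' := by linarith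
  have hgrow : ∀ z : ℂ, r' < ‖z‖ → r' < ‖mapH a b z‖ := fun z hz => by
    have := hR'.le_norm_mapF hab (z := z) (by linarith)
    rw [mapF_zero_right] at this
    linarith
  -- Induction on the number of iterates needed to leave the disc of radius `r'`. On the connected
  -- set `H⁻¹(S) ∩ V` both `θ` and the identity lift the same map and agree near infinity; radiality
  -- is carried along to keep these sets connected.
  have key : ∀ j : ℕ, ∃ S ⊆ V, IsRadial S ∧ {z : ℂ | r' < ‖z‖} ⊆ S ∧ Set.EqOn θ id S ∧
      ∀ z ∈ V, r' < ‖(mapH a b)^[j] z‖ → z ∈ S := by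
    intro j
    induction j with
    | zero =>
      refine ⟨{z | r' < ‖z‖}, fun z hz => hV.large (lt_of_le_of_lt hr1 hz), fun z hz t ht => ?_,
        subset_rfl, fun z hz => hr z (lt_of_le_of_lt (le_max_left _ _) hz), fun z _ hz => hz⟩
      have h1 : r' < ‖z‖ := hz
      show r' < ‖(t : ℂ) * z‖
      rw [norm_mul, Complex.norm_real, Real.norm_of_nonneg (by linarith)]
      nlinarith [norm_nonneg z]
    | succ j ih =>
      obtain ⟨S, hSV, hrad, hbig, heq, hmem⟩ := ih
      have hrad' : IsRadial (mapH a b ⁻¹' S ∩ V) := fun z hz t ht => by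
        refine ⟨?_, hV.radial z hz.2 t ht⟩
        rw [Set.mem_preimage, mapH_real_mul]
        exact hrad _ hz.1 _ (one_le_pow₀ ht)
      have hbig' : {z : ℂ | r' < ‖z‖} ⊆ mapH a b ⁻¹' S ∩ V := fun z hz =>
        ⟨hbig (hgrow z hz), hSV (hbig hz)⟩
      have hx : ((r' + 1 : ℝ) : ℂ) ∈ {z : ℂ | r' < ‖z‖} := by
        show r' < ‖((r' + 1 : ℝ) : ℂ)‖
        rw [Complex.norm_real, Real.norm_of_nonneg (by linarith)]
        linarith
      refine ⟨mapH a b ⁻¹' S ∩ V, Set.inter_subset_right, hrad', hbig', ?_,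
        fun z hz hzr => ⟨hmem _ (hV.mapsTo hz) hzr, hz⟩⟩
      refine eqOn_of_mapF_eq (c := 0) hab (hrad'.isPreconnected (fun h => hV.zero_notMem h.2)
        hrpos hbig') (hθ.mono Set.inter_subset_right) continuousOn_id (fun z hz => ?_)
        (fun z hz h => hV.zero_notMem (h ▸ hz.2)) (hbig' hx) ?_
      · rw [mapF_zero_right, mapF_zero_right, hcomm z hz.2, heq hz.1]
        rfl
      · exact hr _ (lt_of_le_of_lt (le_max_left _ _) hx)
  intro z hz
  have h1 : Tendsto (fun n : ℕ => ‖(mapH a b)^[n] z‖) atTop atTop :=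
    mem_escapingSet_iff.1 (hVI hz)
  obtain ⟨j, hj⟩ := (h1.eventually_gt_atTop r').exists
  obtain ⟨S, -, -, -, heq, hmem⟩ := key j
  exact heq (hmem z hz hj)

/-- The composition `Ψ₂ ∘ φ` commutes with `H` and is the identity near infinity, so
`IsAdmissible.eqOn_id` applies. Working in the plane of `H` makes the connectedness of radial sets
available. -/
theorem IsConjPair.eqOn_of_extension (hab : ‖b‖ < ‖a‖)
    (hR' : IsLargeRadius a b 0 c R) (hV : IsAdmissible a b R V)
    (hVI : V ⊆ escapingSet (mapH a b)) (hP : IsConjPair a b c R V U φ Ψ) {Ψ₂ : ℂ → ℂ}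
    (hΨ₂ : ContinuousOn Ψ₂ U) (hconj : ∀ z ∈ U, mapH a b (Ψ₂ z) = Ψ₂ (mapF a b c z)) {r : ℝ}
    (hr : ∀ z, r < ‖z‖ → Ψ₂ z = conjLim a b c 0 z) : Set.EqOn Ψ₂ Ψ U := by
  have key : Set.EqOn (Ψ₂ ∘ φ) id V := by
    refine hV.eqOn_id hab hR' hVI (hΨ₂.comp hP.continuousOn hP.mapsTo) (fun z hz => ?_)
      (r := max (r + 1) (R + 5)) fun z hz => ?_
    · rw [Function.comp_apply, hconj _ (hP.mapsTo hz), hP.semiconj z hz]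
      rfl
    · have h1 : r + 1 < ‖z‖ := (le_max_left _ _).trans_lt hz
      have h2 : R + 5 < ‖z‖ := (le_max_right _ _).trans_lt hz
      have h3 := hR'.norm_conjLim_sub_le hab (z := z) (by linarith)
      rw [← hP.near z (by linarith)] at h3
      have h5 := norm_sub_norm_le z (φ z)
      rw [norm_sub_rev] at h5
      have hzV : z ∈ V := hV.large (by show R + 1 < ‖z‖; linarith)
      rw [Function.comp_apply, hr _ (by linarith), ← hP.near_inv _ (by linarith),
        hP.left_inv hzV]
  intro z hz
  have := key (hP.mapsTo_inv hz)
  rwa [Function.comp_apply, hP.right_inv hz] at this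

theorem IsConjPair.isQuasiconformalOn (hP : IsConjPair a b c R V U φ Ψ) {Ψ₂ : ℂ → ℂ}
    (h : Set.EqOn Ψ₂ Ψ U) : IsQuasiconformalOn Ψ₂ U := by
  obtain ⟨K, hK, hd⟩ := hP.distortion
  refine isQuasiconformalOn_of_contDiffOn hP.isOpen
    (hP.right_inv.injOn.congr h.symm) (hP.contDiffOn.congr h) hK fun z hz => ?_
  have : Ψ₂ =ᶠ[𝓝 z] Ψ := by filter_upwards [hP.isOpen.mem_nhds hz] with y hy using h hy
  rw [this.fderiv_eq]
  exact hd z hz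

/-! ### Non-extendability over the critical point -/

theorem IsLargeRadius.tendsto_bottcherSeq (hab : ‖b‖ < ‖a‖) (hR : IsLargeRadius a b c 0 R)
    {z : ℂ} (hz : R ≤ ‖z‖) :
    Tendsto (fun k => bottcherSeq a b c k z) atTop (𝓝 (conjLim a b c 0 z)) := by
  simpa only [conjSeq_zero_right] using hR.tendsto_conjSeq hab hz

/-- A Böttcher map cannot be extended over the critical point. -/
theorem IsConjPair.not_exists_extension (hab : ‖b‖ < ‖a‖) (hR : IsLargeRadius a b c 0 R)
    (hR' : IsLargeRadius a b 0 c R) (hV : IsAdmissible a b R V)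
    (hVI : V ⊆ escapingSet (mapH a b)) (hP : IsConjPair a b c R V U φ Ψ)
    (hU : U ⊆ escapingSet (mapF a b c)) (hc : c ∈ U) :
    ¬ ∃ Ψ₂ : ℂ → ℂ, IsBottcherExtension a b c Ψ₂ (escapingSet (mapF a b c)) := by
  rintro ⟨Ψ₂, ⟨r, hr⟩, -, hcont, hconj⟩
  have h4 := hR.four_le
  have hm := sub_pos.2 hab
  set E := escapingSet (mapF a b c)
  have hlim : ∀ z, max r R < ‖z‖ → Ψ₂ z = conjLim a b c 0 z := fun z hz =>
    tendsto_nhds_unique (hr z ((le_max_left _ _).trans_lt hz)).2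
      (hR.tendsto_bottcherSeq hab ((le_max_right _ _).trans hz.le))
  have heq : Set.EqOn Ψ₂ Ψ U := hP.eqOn_of_extension hab hR' hV hVI (hcont.mono hU)
    (fun z hz => hconj z (hU hz)) hlim
  set w := Ψ c
  have hwV : w ∈ V := hP.mapsTo_inv hc
  have hφw : φ w = c := hP.right_inv hc
  have hw0 : w ≠ 0 := fun h => hV.zero_notMem (h ▸ hwV)
  obtain ⟨v, hv⟩ := mapH_surjective hab w
  have hv0 : v ≠ 0 := fun h => hw0 (by rw [← hv, h, mapH_zero])
  -- On this open ray `φ ∘ H` avoids `c`, and it tends to `c` at the endpoint `v`. Its lift `χ`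
  -- through `f` is thus a curve from infinity that ends at the critical point 0.
  set X : Set ℂ := (fun t : ℝ => (t : ℂ) * v) '' Set.Ioi 1
  have hXrad : IsRadial X := by
    rintro _ ⟨t, ht, rfl⟩ s hs
    refine ⟨s * t, ?_, by push_cast; ring⟩
    have ht' : 1 < t := ht
    show 1 < s * t
    nlinarith
  have hX0 : (0 : ℂ) ∉ X := by
    rintro ⟨t, ht, h⟩
    have ht' : 1 < t := ht
    rcases mul_eq_zero.1 h with h | h
    · rw [Complex.ofReal_eq_zero] at h
      linarith
    · exact hv0 h
  have hXpre : IsPreconnected X := isPreconnected_Ioi.image _ (by fun_prop)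
  have hXV : Set.MapsTo (mapH a b) X V := by
    rintro _ ⟨t, ht, rfl⟩
    rw [mapH_real_mul, hv]
    exact hV.radial w hwV _ (one_le_pow₀ (le_of_lt ht))
  have hXc : ∀ z ∈ X, φ (mapH a b z) ≠ c := by
    intro z hz h
    have h1 : mapH a b z = w := hP.left_inv.injOn (hXV hz) hwV (h.trans hφw.symm)
    obtain ⟨t, ht, rfl⟩ := hz
    have ht' : 1 < t := ht
    rw [mapH_real_mul, hv, mul_eq_right₀ hw0, Complex.ofReal_eq_one] at h1
    nlinarith
  obtain ⟨χ, hχc, hχ, hχn⟩ := hP.exists_lift hab hR' hXrad hX0 hXV hXc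
  have hχE : ∀ z ∈ X, χ z ∈ E := fun z hz => by
    rw [← apply_mem_escapingSet_iff, hχ z hz]
    exact hU (hP.mapsTo (hXV hz))
  have hnegE : ∀ z ∈ E, -z ∈ E := fun z hz => by
    rw [← apply_mem_escapingSet_iff] at hz ⊢
    rwa [mapF_neg]
  have hHχ : ∀ z ∈ X, mapH a b (Ψ₂ (χ z)) = mapH a b z := fun z hz => by
    rw [hconj _ (hχE z hz), hχ z hz, heq (hP.mapsTo (hXV hz)), hP.left_inv (hXV hz)]
  have hHχ' : ∀ z ∈ X, mapH a b (Ψ₂ (-χ z)) = mapH a b z := fun z hz => by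
    rw [hconj _ (hnegE _ (hχE z hz)), mapF_neg, ← hconj _ (hχE z hz), hHχ z hz]
  -- Both sides have the same image under `H`, and far out they agree since the Böttcher map is odd
  -- there. The sign cannot change along the connected ray.
  have hsign : Set.EqOn (fun z => Ψ₂ (χ z)) (fun z => -Ψ₂ (-χ z)) X := by
    have hvn : 0 < ‖v‖ := norm_pos_iff.2 hv0
    -- Large enough that `χ x`, which is within 1 of `x`, still lies where `Ψ₂` is known to be the
    -- Böttcher map.
    set m := max r R + R + 5
    have hm0 : 0 < m / ‖v‖ := by
      have := le_max_right r R
      apply div_pos _ hvn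
      linarith
    have hx : ((1 + m / ‖v‖ : ℝ) : ℂ) * v ∈ X := ⟨_, by simpa using hm0, rfl⟩
    have hxn : m ≤ ‖((1 + m / ‖v‖ : ℝ) : ℂ) * v‖ := by
      rw [norm_mul, Complex.norm_real, Real.norm_of_nonneg (by linarith), add_mul,
        div_mul_cancel₀ _ hvn.ne']
      linarith
    set x := ((1 + m / ‖v‖ : ℝ) : ℂ) * v
    refine eqOn_of_mapF_eq (c := 0) hab hXpre (hcont.comp hχc hχE)
      (hcont.comp hχc.neg fun z hz => hnegE _ (hχE z hz)).neg (fun z hz => ?_)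
      (fun z hz h => ?_) hx ?_
    · rw [mapF_zero_right, mapF_zero_right, mapH_neg, hHχ z hz, hHχ' z hz]
    · have h1 := hHχ' z hz
      rw [neg_eq_zero.1 h, mapH_zero] at h1
      exact hV.zero_notMem (h1 ▸ hXV hz)
    · have h5 := le_max_right r R
      have h6 := hR'.norm_conjLim_sub_le hab (z := x) (by linarith)
      rw [← hχn x hx (by linarith)] at h6
      have h7 := norm_sub_norm_le x (χ x)
      rw [norm_sub_rev] at h7
      have h8 : max r R < ‖χ x‖ := by linarith
      rw [hlim _ h8, hlim _ (by rwa [norm_neg]), hR.conjLim_neg hab (by linarith), neg_neg]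
  have hmemX : ∀ᶠ t : ℝ in 𝓝[>] 1, (t : ℂ) * v ∈ X := by
    filter_upwards [self_mem_nhdsWithin] with t ht using ⟨t, ht, rfl⟩
  have hχ0 : Tendsto (fun t : ℝ => χ ((t : ℂ) * v)) (𝓝[>] 1) (𝓝 0) := by
    have h1 : Tendsto (fun t : ℝ => mapH a b ((t : ℂ) * v)) (𝓝[>] 1) (𝓝[V] w) := by
      refine tendsto_nhdsWithin_iff.2 ⟨?_, hmemX.mono fun t ht => hXV ht⟩
      have h2 : Continuous fun t : ℝ => mapH a b ((t : ℂ) * v) :=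
        (continuous_mapH a b).comp (by fun_prop)
      have h3 := h2.tendsto 1
      rw [Complex.ofReal_one, one_mul, hv] at h3
      exact h3.mono_left nhdsWithin_le_nhds
    have h2 : Tendsto (fun t : ℝ => φ (mapH a b ((t : ℂ) * v)) - c) (𝓝[>] 1) (𝓝 0) := by
      have h3 := (hP.continuousOn w hwV).tendsto
      rw [hφw] at h3
      simpa using (h3.comp h1).sub_const c
    have h3 : Tendsto (fun t : ℝ => √‖φ (mapH a b ((t : ℂ) * v)) - c‖ / (‖a‖ - ‖b‖)) (𝓝[>] 1)
        (𝓝 0) := by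
      simpa using (h2.norm.sqrt).div_const (‖a‖ - ‖b‖)
    refine squeeze_zero_norm' ?_ h3
    filter_upwards [hmemX] with t ht
    rw [← hχ _ ht, mapF, add_sub_cancel_right, mapH, norm_pow, Real.sqrt_sq (norm_nonneg _),
      le_div_iff₀ hm, mul_comm]
    exact le_norm_stretch a b _
  have h0E : (0 : ℂ) ∈ E := by
    rw [← apply_mem_escapingSet_iff, mapF_zero]
    exact hU hc
  have hΨ0 : Tendsto Ψ₂ (𝓝[E] 0) (𝓝 (Ψ₂ 0)) := hcont 0 h0E
  have ht1 : Tendsto (fun t : ℝ => Ψ₂ (χ ((t : ℂ) * v))) (𝓝[>] 1) (𝓝 (Ψ₂ 0)) :=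
    hΨ0.comp (tendsto_nhdsWithin_iff.2 ⟨hχ0, hmemX.mono fun t ht => hχE _ ht⟩)
  have ht2 : Tendsto (fun t : ℝ => -Ψ₂ (-χ ((t : ℂ) * v))) (𝓝[>] 1) (𝓝 (-Ψ₂ 0)) := by
    refine (hΨ0.comp (tendsto_nhdsWithin_iff.2 ⟨?_, hmemX.mono fun t ht =>
      hnegE _ (hχE _ ht)⟩)).neg
    simpa using hχ0.neg
  -- Both `χ` and `-χ` tend to 0, so continuity of `Ψ₂` at 0 turns the oddness along the curve into
  -- `Ψ₂ 0 = 0`.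
  have h1 : Ψ₂ 0 = -Ψ₂ 0 :=
    tendsto_nhds_unique (ht1.congr' (hmemX.mono fun t ht => hsign ht)) ht2
  have h2 := hconj 0 h0E
  rw [self_eq_neg.1 h1, mapH_zero, mapF_zero, heq hc] at h2
  exact hw0 h2.symm

end

/-! ### The two cases, by exhausting the escaping set with iterated preimages -/

theorem theorem2p4 (a b c : ℂ) (hab : ‖b‖ < ‖a‖) :
    ((0 : ℂ) ∉ escapingSet (mapF a b c) →
      ∃ Ψ : ℂ → ℂ,
        IsBottcherExtension a b c Ψ (escapingSet (mapF a b c)) ∧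
        Set.InjOn Ψ (escapingSet (mapF a b c)) ∧
        IsLocallyQuasiconformalOn Ψ (escapingSet (mapF a b c)) ∧
        Set.MapsTo Ψ (escapingSet (mapF a b c)) (escapingSet (mapH a b))) ∧
    ((0 : ℂ) ∈ escapingSet (mapF a b c) →
      (¬ ∃ Ψ : ℂ → ℂ, IsBottcherExtension a b c Ψ (escapingSet (mapF a b c))) ∧
      ∃ (D : Set ℂ) (Ψ : ℂ → ℂ),
        IsOpen D ∧ IsConnected D ∧ D ⊆ escapingSet (mapF a b c) ∧ c ∈ D ∧
        IsBottcherExtension a b c Ψ D ∧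
        IsQuasiconformalOn Ψ D ∧
        Set.MapsTo Ψ D (escapingSet (mapH a b))) := by
  classical
  obtain ⟨R, hR, hR'⟩ :=
    ((eventually_isLargeRadius hab c 0).and (eventually_isLargeRadius hab 0 c)).exists
  have h4 := hR.four_le
  have hbase := isConjPair_base hab hR hR'
  have hadm := hR'.isAdmissible hab
  set V₀ : Set ℂ := {z | R + 1 < ‖z‖}
  set U₀ : Set ℂ := {z | R < ‖z‖ ∧ R + 1 < ‖conjLim a b c 0 z‖}
  set E := escapingSet (mapF a b c)
  let V := preimages (mapH a b) V₀
  let U := preimages (mapF a b c) U₀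
  have hVadm : ∀ n, IsAdmissible a b R (V n) := hadm.preimages
  have hUE : ∀ n, U n ⊆ E := preimages_subset
    (fun z hz => hR.mem_escapingSet hab hz.1.le) fun z => apply_mem_escapingSet_iff.1
  have hVE : ∀ n, V n ⊆ escapingSet (mapH a b) := preimages_subset
    (fun z hz => by
      have h1 : R + 1 < ‖z‖ := hz
      have := hR'.mem_escapingSet hab (z := z) (by linarith)
      rwa [funext (mapF_zero_right a b)] at this) fun z => apply_mem_escapingSet_iff.1
  have hUmono : Monotone U := preimages_mono fun z hz => (hbase.conj_inv hadm.mapsTo hz).1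
  have hEU : ∀ z ∈ E, ∃ n, z ∈ U n := fun z hz => by
    have h1 : Tendsto (fun n : ℕ => ‖(mapF a b c)^[n] z‖) atTop atTop :=
      mem_escapingSet_iff.1 hz
    obtain ⟨n, hn⟩ := (h1.eventually_ge_atTop (R + 4)).exists
    exact ⟨n, mem_preimages.2 (hbase.largeU _ hn)⟩
  constructor
  · intro h0
    have hcE : c ∉ E := fun h => h0 (by
      rw [← apply_mem_escapingSet_iff, mapF_zero]; exact h)
    choose φ Ψ hP using fun n => exists_isConjPair hab hR hR' hadm hbase n
      fun k _ hk => hcE (hUE k hk)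
    have hΨeq : ∀ m n, m ≤ n → Set.EqOn (Ψ n) (Ψ m) (U m) := fun m n hmn =>
      (hP m).eqOn_of_extension hab hR' (hVadm m) (hVE m)
        ((hP n).contDiffOn.continuousOn.mono (hUmono hmn))
        (fun z hz => ((hP n).conj_inv (hVadm n).mapsTo (hUmono hmn hz)).2) (r := R + 4)
        fun z hz => (hP n).near_inv z hz.le
    -- The conjugacies are compatible on the increasing sets `U n`, so the choice of index is
    -- immaterial; the value 0 is used only outside `E`.
    let Ψ' : ℂ → ℂ := fun z => if h : ∃ n, z ∈ U n then Ψ (Nat.find h) z else 0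
    have hΨ' : ∀ n, Set.EqOn Ψ' (Ψ n) (U n) := fun n z hz => by
      have h : ∃ n, z ∈ U n := ⟨n, hz⟩
      simp only [Ψ', dif_pos h]
      exact (hΨeq _ n (Nat.find_min' h hz) (Nat.find_spec h)).symm
    refine ⟨Ψ', ⟨⟨R + 4, fun z hz => ?_⟩, fun z hz => apply_mem_escapingSet_iff.2 hz,
      fun z hz => ?_, fun z hz => ?_⟩, fun z hz w hw h => ?_, fun z hz => ?_, fun z hz => ?_⟩
    · have hz0 : z ∈ U 0 := (hP 0).largeU z hz.le
      rw [hΨ' 0 hz0, (hP 0).near_inv z hz.le]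
      exact ⟨hUE 0 hz0, hR.tendsto_bottcherSeq hab (by linarith)⟩
    · obtain ⟨n, hn⟩ := hEU z hz
      exact (((hP n).contDiffOn.continuousOn.congr (hΨ' n)).continuousAt
        ((hP n).isOpen.mem_nhds hn)).continuousWithinAt
    · obtain ⟨n, hn⟩ := hEU z hz
      have h1 := (hP n).conj_inv (hVadm n).mapsTo hn
      rw [hΨ' n hn, hΨ' n h1.1, h1.2]
    · obtain ⟨n, hn⟩ := hEU z hz
      obtain ⟨m, hm⟩ := hEU w hw
      have hn' := hUmono (le_max_left n m) hn
      have hm' := hUmono (le_max_right n m) hm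
      rw [hΨ' _ hn', hΨ' _ hm'] at h
      exact (hP _).right_inv.injOn hn' hm' h
    · obtain ⟨n, hn⟩ := hEU z hz
      exact ⟨U n, hn, hUE n, (hP n).isQuasiconformalOn (hΨ' n)⟩
    · obtain ⟨n, hn⟩ := hEU z hz
      rw [hΨ' n hn]
      exact hVE n ((hP n).mapsTo_inv hn)
  · intro h0
    have hcE : c ∈ E := by
      rw [← apply_mem_escapingSet_iff, mapF_zero] at h0; exact h0
    have hex := hEU c hcE
    -- With the least such index, `c` is in none of the earlier sets, so all `N` pullbacks are
    -- permitted and the final domain contains `c`.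
    set N := Nat.find hex
    have hcN : c ∈ U N := Nat.find_spec hex
    obtain ⟨φ, Ψ, hP⟩ := exists_isConjPair hab hR hR' hadm hbase N
      fun k hk => Nat.find_min hex hk
    refine ⟨hP.not_exists_extension hab hR hR' (hVadm N) (hVE N) (hUE N) hcN, U N, Ψ, hP.isOpen,
      ⟨⟨c, hcN⟩, ?_⟩, hUE N, hcN, ⟨⟨R + 4, fun z hz => ⟨hP.largeU z hz.le, ?_⟩⟩,
        fun z hz => (hP.conj_inv (hVadm N).mapsTo hz).1, hP.contDiffOn.continuousOn,
        fun z hz => (hP.conj_inv (hVadm N).mapsTo hz).2⟩, hP.isQuasiconformalOn fun z _ => rfl,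
      fun z hz => hVE N (hP.mapsTo_inv hz)⟩
    -- The domain `U N` is connected as the continuous image of the radial set `V N`.
    · have himg : φ '' V N = U N := Set.Subset.antisymm hP.mapsTo.image_subset
        fun z hz => ⟨Ψ z, hP.mapsTo_inv hz, hP.right_inv hz⟩
      rw [← himg]
      exact ((hVadm N).isPreconnected h4).image _ hP.continuousOn
    · rw [hP.near_inv z hz.le]
      exact hR.tendsto_bottcherSeq hab (by linarith)
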